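/- **Setting.** Let $b\in\{32,64\}$ and let $\mathbb F_{32},\mathbb F_{64}$ be the finite FP32 and FP64 numbers (subnormal numbers included), with unit roundoffs $u_{32}=2^{-24}$, $u_{64}=2^{-53}$. Let $\mathrm{fl}_b$ be rounding to nearest-even in format $b$ (gradual underflow, no overflow), $\mathrm{single}_\triangledown$ and $\mathrm{single}_\vartriangle$ rounding down and up to FP32, $\mathrm{double}=\mathrm{fl}_{64}$. Let $2\le N\le 49$ and let $p_1,\dots,p_N$ be the first $N$ of the pairwise coprime moduli 256, 255, 253, 251, 247, 241, 239, 233, 229, 227, 223, 217, 211, 199, 197, 193, 191, 181, 179, 173, 167, 163, 157, 151, 149, 139, 137, 131, 127, 113, 109, 107, 103, 101, 97, 89, 83, 79, 73, 71, 67, 61, 59, 53, 47, 43, 41, 37, 29. Put $\mathcal P=\prod_\ell p_\ell$, $\rho=\sum_\ell\lfloor p_\ell/2\rfloor$, let $0\le q_\ell<p_\ell$ be the inverse of $\mathcal P/p_\ell$ modulo $p_\ell$, and $w_\ell=(\mathcal P/p_\ell)q_\ell$. Let $\mathrm{log2f}$ be any function mapping every $x\in\mathbb F_{32}$ with $x\ge1$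 to a number in $\mathbb F_{32}$ with $|\mathrm{log2f}(x)-\log_2x|\le4u_{32}\log_2x$. Let $k\le2^{17}$, $A\in\mathbb F_b^{m\times k}$, $B\in\mathbb F_b^{k\times n}$, and assume that no row and no column of $|A||B|$ is identically zero. Write $\mathrm{mod}(x,p)=x-p\,\mathrm{round}(x/p)$. **Algorithm OS_II.** *Scaling:* $\alpha_i=\lfloor\log_2\max_h|a_{ih}|\rfloor$, $\beta_j=\lfloor\log_2\max_h|b_{hj}|\rfloor$, $\mu'_i=5-\alpha_i$, $\nu'_j=5-\beta_j$, $\bar A=\lceil\mathrm{diag}(2^{\mu'})|A|\rceil$, $\bar B=\lceil|B|\mathrm{diag}(2^{\nu'})\rceil$, $\bar C=\bar A\bar B$ (INT8 inputs, INT32 accumulation), $\bar D=\mathrm{single}_\vartriangle(\bar C)$, $\mathcal P'=\mathrm{single}_\triangledown(\tfrac12\log_2(\mathcal P-1)-\tfrac12)$, $c=\mathrm{single}_\triangledown(-0.5/(1-4u_{32}))$, $$\mu_i=\mu'_i+\lfloor\mathrm{single}_\triangledown(c\,\mathrm{log2f}(\max_h\bar d_{ih})+\mathcal P')\rfloor,\qquad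 \nu_j=\nu'_j+\lfloor\mathrm{single}_\triangledown(c\,\mathrm{log2f}(\max_h\bar d_{hj})+\mathcal P')\rfloor,$$ $A'=\mathrm{trunc}(\mathrm{diag}(2^\mu)A)$, $B'=\mathrm{trunc}(B\,\mathrm{diag}(2^\nu))$. *CRT:* $W_\ell=\mathrm{mod}(\mathrm{mod}(A',p_\ell)\,\mathrm{mod}(B',p_\ell),p_\ell)$, where the residues are held in INT8 and the products in INT32 (two's complement wrap-around). $\mathcal P_1=\mathrm{double}(\mathcal P)$, $\mathcal P_{inv}=\mathrm{double}(1/\mathcal P)$. If $b=32$: $\mathcal P_2=0$, $s_{\ell1}=\mathrm{double}(w_\ell)$, $s_{\ell2}=0$. If $b=64$: $\mathcal P_2=\mathrm{double}(\mathcal P-\mathcal P_1)$, $s_{\ell1}$ consists of the leading $53-\lceil\log_2\rho\rceil+\lfloor\log_2w_\ell\rfloor-\lfloor\log_2\max_hw_h\rfloor$ bits of $w_\ell$, and $s_{\ell2}=\mathrm{double}(w_\ell-s_{\ell1})$. $C'^{(1)}$ and $C'^{(2)}$ are $\sum_\ell s_{\ell1}W_\ell$ and $\sum_\ell s_{\ell2}W_\ell$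 computed in FP64 (each product and each addition rounded), in any fixed orders of summation; $Q=\mathrm{round}(\mathrm{fl}_{64}(\mathcal P_{inv}C'^{(1)}))$; $$C''=\mathrm{fl}_{64}\bigl(-Q\mathcal P_2+\mathrm{fl}_{64}(\mathrm{fl}_{64}(-Q\mathcal P_1+C'^{(1)})+C'^{(2)})\bigr),$$ rounded once more to FP32 if $b=32$. *Output:* $(C_b)_{ij}=\mathrm{fl}_b\bigl(\mathrm{fl}_b(2^{-\mu_i}C''_{ij})\,2^{-\nu_j}\bigr)$. **Theorem.** Let $\alpha'_i=\alpha_i+\frac12\log_2\max_h\bar c_{ih}$, $\beta'_j=\beta_j+\frac12\log_2\max_h\bar c_{hj}$, $t=1/\sqrt{2^5(\mathcal P-1)}$, $v=(1,\dots,1)^T\in\mathbb Z^k$, $E$ the all-ones matrix, $$R_{32}=(1+u_{32})(N+2)u_{64}\rho\mathcal P E+u_{32}|A'B'|,\qquad R_{64}=(1+3u_{64})2^{1+\lceil\log_2\rho\rceil}(N+2)u_{64}^2\rho\mathcal P E+3u_{64}|A'B'|,$$ and let $r_b$ be the scalar obtained from $R_b$ by replacing $E$ by $1$ and $|A'B'|$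 by $\mathcal P/2$. Then, for every entry $(i,j)$ at which neither multiplication of the output step underflows (the exact values $2^{-\mu_i}C''_{ij}$ and $2^{-\mu_i}C''_{ij}2^{-\nu_j}$ are each zero or of modulus at least the smallest positive normal number of format $b$), $$|AB-C_b|\le t|A|v(2^{\beta'})^T+t2^{\alpha'}v^T|B|+(kE+R_b)\circ t^22^{\alpha'}(2^{\beta'})^T$$ holds at $(i,j)$, and at every entry the right-hand side is at most $$t|A|v(2^{\beta'})^T+t2^{\alpha'}v^T|B|+(k+r_b)t^22^{\alpha'}(2^{\beta'})^T.$$ -/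

import Mathlib

noncomputable section

namespace OzakiII

/-! ### Binary floating-point formats and rounding -/

/-- The two IEEE formats: FP32 (`b = 32`) and FP64 (`b = 64`). -/
inductive Fmt where
  | fp32
  | fp64

/-- Number of significand bits. -/
def Fmt.prec : Fmt → ℕ
  | .fp32 => 24
  | .fp64 => 53

/-- Exponent of the smallest positive (subnormal) number. -/
def Fmt.qmin : Fmt → ℤ
  | .fp32 => -149
  | .fp64 => -1074

/-- Exponent of the unit in the last place of the largest finite number. -/
def Fmt.qmax : Fmt → ℤ
  | .fp32 => 104
  | .fp64 => 971

/-- Unit roundoff: `2 ^ (-24)` for FP32 and `2 ^ (-53)` for FP64. -/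
def Fmt.u (b : Fmt) : ℝ := (2 : ℝ) ^ (-(b.prec : ℤ))

/-- Smallest positive normal number: `2 ^ (-126)` for FP32 and `2 ^ (-1022)` for FP64. -/
def Fmt.minNormal (b : Fmt) : ℝ := (2 : ℝ) ^ (b.qmin + b.prec - 1)

/-- The finite floating-point numbers of the format, subnormal numbers included. -/
def Fmt.F (b : Fmt) : Set ℝ :=
  {x | ∃ M e : ℤ, |M| < 2 ^ b.prec ∧ b.qmin ≤ e ∧ e ≤ b.qmax ∧ x = (M : ℝ) * (2 : ℝ) ^ e}

/-- Spacing of the floating-point grid at `x` (gradual underflow at the bottom). -/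
def Fmt.ulp (b : Fmt) (x : ℝ) : ℝ :=
  (2 : ℝ) ^ max (⌊Real.logb 2 |x|⌋ - (b.prec : ℤ) + 1) b.qmin

/-- Nearest integer, ties to even. -/
def roundEven (x : ℝ) : ℤ :=
  if Int.fract x < 1 / 2 then ⌊x⌋
  else if 1 / 2 < Int.fract x then ⌊x⌋ + 1
  else if Even ⌊x⌋ then ⌊x⌋ else ⌊x⌋ + 1

/-- Round to nearest, ties to even. As long as there is no overflow this is the IEEE rounding;
overflow is not modelled, i.e. the grid is not cut off at the largest finite number. -/
def Fmt.rn (b : Fmt) (x : ℝ) : ℝ := (roundEven (x / b.ulp x) : ℝ) * b.ulp x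

/-- Round down (towards `-∞`). -/
def Fmt.rd (b : Fmt) (x : ℝ) : ℝ := (⌊x / b.ulp x⌋ : ℝ) * b.ulp x

/-- Round up (towards `+∞`). -/
def Fmt.ru (b : Fmt) (x : ℝ) : ℝ := (⌈x / b.ulp x⌉ : ℝ) * b.ulp x

/-- An operation of format `b` with exact result `x` does not underflow. -/
def Fmt.NoUnderflow (b : Fmt) (x : ℝ) : Prop := x = 0 ∨ b.minNormal ≤ |x|

/-- The accuracy assumption on the hardware base-two logarithm in FP32: it maps FP32 numbers to
FP32 numbers with `|log2f x - log2 x| ≤ 4 u₃₂ log2 x`. It is required only for `1 ≤ x`, where the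
right-hand side is nonnegative. -/
def IsLog2f (log2f : ℝ → ℝ) : Prop :=
  ∀ x ∈ Fmt.fp32.F, 1 ≤ x →
    log2f x ∈ Fmt.fp32.F ∧ |log2f x - Real.logb 2 x| ≤ 4 * Fmt.fp32.u * Real.logb 2 x

/-- An order of evaluation of a sum: a binary tree whose leaves are the indices of the terms. -/
inductive SumTree (ι : Type) where
  | leaf : ι → SumTree ι
  | node : SumTree ι → SumTree ι → SumTree ι

/-- The indices at the leaves. -/
def SumTree.leaves {ι : Type} : SumTree ι → List ι
  | .leaf i => [i]
  | .node l r => l.leaves ++ r.leaves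

/-- The tree contains every index in `Fin N` exactly once. -/
def SumTree.IsOrder {N : ℕ} (τ : SumTree (Fin N)) : Prop := τ.leaves.Perm (List.finRange N)

/-- `fl (∑ x ℓ * y ℓ)` in FP64: every product and every addition is rounded to nearest. -/
def SumTree.flDot {ι : Type} (x y : ι → ℝ) : SumTree ι → ℝ
  | .leaf i => Fmt.fp64.rn (x i * y i)
  | .node l r => Fmt.fp64.rn (l.flDot x y + r.flDot x y)

/-! ### Integer arithmetic -/

/-- Integer part (rounding towards zero). -/
def trunc (x : ℝ) : ℤ := if 0 ≤ x then ⌊x⌋ else ⌈x⌉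

/-- Symmetric remainder `x - p * round (x / p)`. -/
def smod (x : ℤ) (p : ℕ) : ℤ := x - p * round ((x : ℝ) / (p : ℝ))

/-- Cast to a `w`-bit signed integer (two's complement wrap-around). -/
def castInt (w : ℕ) (x : ℤ) : ℤ := Int.bmod x (2 ^ w)

/-- INT8 matrix engine: INT8 inputs, INT32 accumulation and output. -/
def int8Gemm {m k n : ℕ} (X : Matrix (Fin m) (Fin k) ℤ) (Y : Matrix (Fin k) (Fin n) ℤ) :
    Matrix (Fin m) (Fin n) ℤ :=
  fun i j => castInt 32 (∑ h, castInt 8 (X i h) * castInt 8 (Y h j))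

/-! ### Moduli and the constants depending on them -/

/-- The fixed list of pairwise coprime moduli. -/
def moduliList : List ℕ :=
  [256, 255, 253, 251, 247, 241, 239, 233, 229, 227,
   223, 217, 211, 199, 197, 193, 191, 181, 179, 173,
   167, 163, 157, 151, 149, 139, 137, 131, 127, 113,
   109, 107, 103, 101, 97, 89, 83, 79, 73, 71,
   67, 61, 59, 53, 47, 43, 41, 37, 29]

/-- The first `N` moduli of the list (`N ≤ 49`). -/
def moduli (N : ℕ) : Fin N → ℕ := fun l => moduliList.getD l 1

section Constants

variable {N : ℕ} (p : Fin N → ℕ)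

/-- `𝒫 = ∏ p_ℓ`. -/
def bigP : ℕ := ∏ l, p l

/-- `ρ = ∑ ⌊p_ℓ / 2⌋`. -/
def rho : ℕ := ∑ l, p l / 2

/-- `⌈log2 ρ⌉`. -/
def ceilLogRho : ℤ := ⌈Real.logb 2 (rho p)⌉

/-- `q_ℓ`, the inverse of `𝒫 / p_ℓ` modulo `p_ℓ` with `q_ℓ < p_ℓ`. -/
def qInv (l : Fin N) : ℕ := ((bigP p / p l : ℕ) : ZMod (p l))⁻¹.val

/-- The CRT weight `𝒫 / p_ℓ * q_ℓ`. -/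
def weight (l : Fin N) : ℕ := bigP p / p l * qInv p l

/-- `β_ℓ`, the number of leading bits kept in `s_{ℓ1}` for DGEMM. -/
def keepBits (l : Fin N) : ℤ :=
  53 - ceilLogRho p + ⌊Real.logb 2 (weight p l)⌋ - ⌊Real.logb 2 (⨆ h, (weight p h : ℝ))⌋

/-- The upper `β` bits of a positive number `x` (the lower bits are cut off). -/
def upperBits (β : ℤ) (x : ℝ) : ℝ :=
  (⌊x / (2 : ℝ) ^ (⌊Real.logb 2 x⌋ + 1 - β)⌋ : ℝ) * (2 : ℝ) ^ (⌊Real.logb 2 x⌋ + 1 - β)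

/-- `s_{ℓ1}`. -/
def s1 (b : Fmt) (l : Fin N) : ℝ :=
  match b with
  | .fp32 => Fmt.fp64.rn (weight p l)
  | .fp64 => upperBits (keepBits p l) (weight p l)

/-- `s_{ℓ2}`. -/
def s2 (b : Fmt) (l : Fin N) : ℝ :=
  match b with
  | .fp32 => 0
  | .fp64 => Fmt.fp64.rn ((weight p l : ℝ) - s1 p .fp64 l)

/-- `𝒫₁ = double(𝒫)`. -/
def P1 : ℝ := Fmt.fp64.rn (bigP p)

/-- `𝒫₂`. -/
def P2 (b : Fmt) : ℝ :=
  match b with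
  | .fp32 => 0
  | .fp64 => Fmt.fp64.rn ((bigP p : ℝ) - P1 p)

/-- `𝒫_inv = double(1 / 𝒫)`. -/
def Pinv : ℝ := Fmt.fp64.rn ((bigP p : ℝ)⁻¹)

/-- `𝒫' = single_▽(log2(𝒫 - 1) / 2 - 0.5)`. -/
def P' : ℝ := Fmt.fp32.rd (Real.logb 2 ((bigP p : ℝ) - 1) / 2 - 1 / 2)

end Constants

/-! ### The function `Scaling` -/

/-- `single_▽(-0.5 / (1 - 4 u₃₂))`. -/
def scaleConst : ℝ := Fmt.fp32.rd (-(1 / 2) / (1 - 4 * Fmt.fp32.u))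

section Scaling

variable {m k n : ℕ} (A : Matrix (Fin m) (Fin k) ℝ) (B : Matrix (Fin k) (Fin n) ℝ)

/-- `α_i = ⌊log2 max_h |a_ih|⌋`. -/
def alpha (i : Fin m) : ℤ := ⌊Real.logb 2 (⨆ h, |A i h|)⌋

/-- `β_j = ⌊log2 max_h |b_hj|⌋`. -/
def beta (j : Fin n) : ℤ := ⌊Real.logb 2 (⨆ h, |B h j|)⌋

/-- `μ'_i`. -/
def mu' (i : Fin m) : ℤ := 5 - alpha A i

/-- `ν'_j`. -/
def nu' (j : Fin n) : ℤ := 5 - beta B j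

/-- `A̅ = ⌈diag(2^μ') |A|⌉`. -/
def Abar : Matrix (Fin m) (Fin k) ℤ := fun i h => ⌈(2 : ℝ) ^ mu' A i * |A i h|⌉

/-- `B̅ = ⌈|B| diag(2^ν')⌉`. -/
def Bbar : Matrix (Fin k) (Fin n) ℤ := fun h j => ⌈|B h j| * (2 : ℝ) ^ nu' B j⌉

/-- `C̅ = A̅ B̅`, computed by INT8 matrix engines. -/
def Cbar : Matrix (Fin m) (Fin n) ℤ := int8Gemm (Abar A) (Bbar B)

/-- `D̅ = single_△(C̅)`. -/
def Dbar : Matrix (Fin m) (Fin n) ℝ := fun i j => Fmt.fp32.ru (Cbar A B i j)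

variable (log2f : ℝ → ℝ) {N : ℕ} (p : Fin N → ℕ)

/-- `μ_i = μ'_i + ⌊fma_▽(scaleConst, e_i, 𝒫')⌋` with `e_i = log2f(max_h d̅_ih)`. -/
def mu (i : Fin m) : ℤ :=
  mu' A i + ⌊Fmt.fp32.rd (scaleConst * log2f (⨆ h, Dbar A B i h) + P' p)⌋

/-- `ν_j = ν'_j + ⌊fma_▽(scaleConst, f_j, 𝒫')⌋` with `f_j = log2f(max_h d̅_hj)`. -/
def nu (j : Fin n) : ℤ :=
  nu' B j + ⌊Fmt.fp32.rd (scaleConst * log2f (⨆ h, Dbar A B h j) + P' p)⌋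

/-- `A' = trunc(diag(2^μ) A)`. -/
def Aint : Matrix (Fin m) (Fin k) ℤ := fun i h => trunc ((2 : ℝ) ^ mu A B log2f p i * A i h)

/-- `B' = trunc(B diag(2^ν))`. -/
def Bint : Matrix (Fin k) (Fin n) ℤ := fun h j => trunc (B h j * (2 : ℝ) ^ nu A B log2f p j)

end Scaling

/-! ### The function `CRT` -/

section CRT

variable {m k n N : ℕ} (b : Fmt) (p : Fin N → ℕ) (τ₁ τ₂ : SumTree (Fin N))
  (A' : Matrix (Fin m) (Fin k) ℤ) (B' : Matrix (Fin k) (Fin n) ℤ)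

/-- `W_ℓ = mod(C'_ℓ, p_ℓ)` in INT8, where `C'_ℓ = mod(A', p_ℓ) mod(B', p_ℓ)` is computed by INT8
matrix engines. -/
def W (l : Fin N) : Matrix (Fin m) (Fin n) ℤ := fun i j =>
  castInt 8 (smod (int8Gemm (fun i h => smod (A' i h) (p l)) (fun h j => smod (B' h j) (p l)) i j)
    (p l))

/-- `C'⁽¹⁾ = fl(∑ s_{ℓ1} W_ℓ)`, summed in the order `τ₁`. -/
def C1 : Matrix (Fin m) (Fin n) ℝ := fun i j =>
  τ₁.flDot (s1 p b) (fun l => (W p A' B' l i j : ℝ))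

/-- `C'⁽²⁾ = fl(∑ s_{ℓ2} W_ℓ)`, summed in the order `τ₂`. -/
def C2 : Matrix (Fin m) (Fin n) ℝ := fun i j =>
  τ₂.flDot (s2 p b) (fun l => (W p A' B' l i j : ℝ))

/-- `Q = round(fl(𝒫_inv C'⁽¹⁾))`. -/
def Q : Matrix (Fin m) (Fin n) ℤ := fun i j =>
  round (Fmt.fp64.rn (Pinv p * C1 b p τ₁ A' B' i j))

/-- `fl(fma(-Q, 𝒫₂, fma(-Q, 𝒫₁, C'⁽¹⁾) + C'⁽²⁾))` in FP64. -/
def Cred : Matrix (Fin m) (Fin n) ℝ := fun i j =>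
  Fmt.fp64.rn (-(Q b p τ₁ A' B' i j : ℝ) * P2 p b +
    Fmt.fp64.rn (Fmt.fp64.rn (-(Q b p τ₁ A' B' i j : ℝ) * P1 p + C1 b p τ₁ A' B' i j) +
      C2 b p τ₂ A' B' i j))

/-- `C''`, rounded to FP32 in the case of SGEMM. -/
def crt : Matrix (Fin m) (Fin n) ℝ := fun i j =>
  match b with
  | .fp32 => Fmt.fp32.rn (Cred .fp32 p τ₁ τ₂ A' B' i j)
  | .fp64 => Cred .fp64 p τ₁ τ₂ A' B' i j

end CRT

/-! ### The function `OS_II` and the quantities in its error bound -/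

section Main

variable {m k n N : ℕ} (b : Fmt) (log2f : ℝ → ℝ) (p : Fin N → ℕ) (τ₁ τ₂ : SumTree (Fin N))
  (A : Matrix (Fin m) (Fin k) ℝ) (B : Matrix (Fin k) (Fin n) ℝ)

/-- `C''` for the scaled and truncated matrices. -/
def Cpp : Matrix (Fin m) (Fin n) ℝ :=
  crt b p τ₁ τ₂ (Aint A B log2f p) (Bint A B log2f p)

/-- The result `C_b = fl(diag(2^(-μ)) C'' diag(2^(-ν)))` of the emulation. -/
def osII : Matrix (Fin m) (Fin n) ℝ := fun i j =>
  b.rn (b.rn ((2 : ℝ) ^ (-mu A B log2f p i) * Cpp b log2f p τ₁ τ₂ A B i j) *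
    (2 : ℝ) ^ (-nu A B log2f p j))

/-- Neither of the two multiplications of the final inverse scaling of entry `(i, j)` underflows. -/
def ScalingNoUnderflow (i : Fin m) (j : Fin n) : Prop :=
  b.NoUnderflow ((2 : ℝ) ^ (-mu A B log2f p i) * Cpp b log2f p τ₁ τ₂ A B i j) ∧
  b.NoUnderflow ((2 : ℝ) ^ (-mu A B log2f p i) * Cpp b log2f p τ₁ τ₂ A B i j *
    (2 : ℝ) ^ (-nu A B log2f p j))

/-- `α'_i = α_i + e'_i / 2` with `e'_i = log2 max_h c̅_ih`. -/
def alpha' (i : Fin m) : ℝ := alpha A i + Real.logb 2 (⨆ h, (Cbar A B i h : ℝ)) / 2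

/-- `β'_j = β_j + f'_j / 2` with `f'_j = log2 max_h c̅_hj`. -/
def beta' (j : Fin n) : ℝ := beta B j + Real.logb 2 (⨆ h, (Cbar A B h j : ℝ)) / 2

/-- `t = 1 / √(2^5 (𝒫 - 1))`. -/
def tConst : ℝ := 1 / Real.sqrt (2 ^ 5 * ((bigP p : ℝ) - 1))

/-- The bound `R_b` for the accumulation and reduction error, as a function of `x = |(A'B')_ij|`. -/
def errR (x : ℝ) : ℝ :=
  match b with
  | .fp32 =>
    (1 + Fmt.fp32.u) * (N + 2) * Fmt.fp64.u * rho p * bigP p + Fmt.fp32.u * x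
  | .fp64 =>
    (1 + 3 * Fmt.fp64.u) * (2 : ℝ) ^ (1 + ceilLogRho p) * (N + 2) * Fmt.fp64.u ^ 2 *
      rho p * bigP p + 3 * Fmt.fp64.u * x

end Main

end OzakiII

end

/-! Write r = 2^(-μ_i), s = 2^(-ν_j), T = (A'B')_ij. Absent underflow the inverse scaling is exact,
because powers of two only move the exponent, so AB - C = (AB - r T s) + r s (T - C'').

The first bracket is the truncation error. Truncation goes towards zero, so the recovered entries of
B do not exceed those of B in modulus, and only |A|v s + r v^T|B| appears, without a second-order
term in k. The exponents satisfy r ≤ 2^(-1/2) t 2^α' and s ≤ 2^(-1/2) t 2^β'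
(`zpow_neg_le_of_le_shift`). The spare factors give r s ≤ t² 2^α' 2^β' / 2, so it is enough to prove
|T - C''| ≤ 2 R_b + 1 (`crt_error`): the half cancels the 2, and the remaining 1/2 is absorbed by k
≥ 1.

The reconstruction starts from the congruences: ∑ w_ℓ W_ℓ = T + 𝒫 Z for an integer Z. The decisive
point is Q = Z exactly, which needs |T|/𝒫 to stay away from 1/2 by more than the floating-point
error of the quotient. The margin 2^(-26) comes from the downward rounding of the constant -0.5/(1 -
4u₃₂) when c̅_ij ≥ 2, and from a numerical check that 𝒫 is not just above a power of two when c̅_ij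
= 1 (`scaled_le`).

Once Q = Z, the rest is rounding error analysis. All FP64 operands in the sums and in the reduction
are multiples of the smallest subnormal number, so these operations have relative error at most u₆₄
even in the subnormal range. For b = 64 the leading parts lie on a common grid coarse enough for
their sum to be exact, which leaves an error of order u₆₄² 𝒫 besides a multiple of u₆₄ |T|. -/

noncomputable section
namespace OzakiII

/-! ### Rounding to nearest -/

/-- The integer multiples of `2 ^ e`. -/
def OnGrid (e : ℤ) (x : ℝ) : Prop := ∃ z : ℤ, x = z * (2 : ℝ) ^ e

theorem OnGrid.mono {e e' : ℤ} {x : ℝ} (h : OnGrid e x) (he : e' ≤ e) : OnGrid e' x := by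
  obtain ⟨z, rfl⟩ := h
  refine ⟨z * 2 ^ (e - e').toNat, ?_⟩
  have h1 : (2 : ℝ) ^ e = 2 ^ (e - e').toNat * 2 ^ e' := by
    rw [← zpow_natCast, Int.toNat_of_nonneg (by omega), ← zpow_add₀ two_ne_zero]
    congr 1; ring
  push_cast
  rw [h1]; ring

theorem OnGrid.add {e : ℤ} {x y : ℝ} (hx : OnGrid e x) (hy : OnGrid e y) : OnGrid e (x + y) := by
  obtain ⟨z, rfl⟩ := hx
  obtain ⟨w, rfl⟩ := hy
  exact ⟨z + w, by push_cast; ring⟩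

theorem OnGrid.mul_int {e : ℤ} {x : ℝ} (hx : OnGrid e x) (n : ℤ) : OnGrid e (x * n) := by
  obtain ⟨z, rfl⟩ := hx
  exact ⟨z * n, by push_cast; ring⟩

theorem OnGrid.sub {e : ℤ} {x y : ℝ} (hx : OnGrid e x) (hy : OnGrid e y) : OnGrid e (x - y) := by
  have := hx.add (hy.mul_int (-1))
  convert this using 1; push_cast; ring

theorem onGrid_int {e : ℤ} (he : e ≤ 0) (z : ℤ) : OnGrid e z :=
  OnGrid.mono ⟨z, by simp⟩ he

theorem zpow_floor_logb_le {x : ℝ} (hx : 0 < x) : (2 : ℝ) ^ ⌊Real.logb 2 x⌋ ≤ x := by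
  rw [← Real.rpow_intCast]
  exact (Real.le_logb_iff_rpow_le one_lt_two hx).1 (Int.floor_le _)

theorem lt_zpow_floor_logb {x : ℝ} (hx : 0 < x) : x < (2 : ℝ) ^ (⌊Real.logb 2 x⌋ + 1) := by
  rw [← Real.rpow_intCast]
  apply (Real.logb_lt_iff_lt_rpow one_lt_two hx).1
  push_cast
  exact Int.lt_floor_add_one _

theorem floor_logb_lt_of_lt_zpow {x : ℝ} {e : ℤ} (hx : 0 < x) (h : x < (2 : ℝ) ^ e) :
    ⌊Real.logb 2 x⌋ < e :=
  (zpow_lt_zpow_iff_right₀ (one_lt_two (α := ℝ))).1 ((zpow_floor_logb_le hx).trans_lt h)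

theorem le_floor_logb_of_zpow_le {x : ℝ} {e : ℤ} (h : (2 : ℝ) ^ e ≤ x) :
    e ≤ ⌊Real.logb 2 x⌋ := by
  have hx : 0 < x := lt_of_lt_of_le (by positivity) h
  exact Int.lt_add_one_iff.1
    ((zpow_lt_zpow_iff_right₀ (one_lt_two (α := ℝ))).1 (h.trans_lt (lt_zpow_floor_logb hx)))

namespace Fmt

theorem ulp_pos (b : Fmt) (x : ℝ) : 0 < b.ulp x := by unfold Fmt.ulp; positivity

theorem u_pos (b : Fmt) : 0 < b.u := by unfold Fmt.u; positivity

theorem abs_roundEven_sub_le (x : ℝ) : |(roundEven x : ℝ) - x| ≤ 1 / 2 := by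
  have h := Int.floor_add_fract x
  have h0 := Int.fract_nonneg x
  have h1 := Int.fract_lt_one x
  unfold roundEven
  split_ifs <;> push_cast <;> rw [abs_le] <;> constructor <;> linarith

theorem roundEven_intCast (z : ℤ) : roundEven (z : ℝ) = z := by
  simp [roundEven]

theorem abs_rn_sub_le (b : Fmt) (x : ℝ) : |b.rn x - x| ≤ b.ulp x / 2 := by
  have hu := b.ulp_pos x
  have h : b.rn x - x = ((roundEven (x / b.ulp x) : ℝ) - x / b.ulp x) * b.ulp x := by
    unfold Fmt.rn; field_simp
  rw [h, abs_mul, abs_of_pos hu]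
  nlinarith [abs_roundEven_sub_le (x / b.ulp x)]

theorem rn_eq_self_of_mul_ulp (b : Fmt) {x : ℝ} (z : ℤ) (h : x = z * b.ulp x) : b.rn x = x := by
  have hu := b.ulp_pos x
  have : x / b.ulp x = z := by rw [div_eq_iff hu.ne']; exact h
  unfold Fmt.rn
  rw [this, roundEven_intCast, ← h]

theorem rn_eq_self_of_onGrid (b : Fmt) {x : ℝ} {e : ℤ} (h : OnGrid e x)
    (hu : b.ulp x ≤ (2 : ℝ) ^ e) : b.rn x = x := by
  have hu' : max (⌊Real.logb 2 |x|⌋ - (b.prec : ℤ) + 1) b.qmin ≤ e :=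
    (zpow_le_zpow_iff_right₀ (one_lt_two (α := ℝ))).1 hu
  obtain ⟨z, hz⟩ := h.mono hu'
  exact b.rn_eq_self_of_mul_ulp z hz

@[simp] theorem rn_zero (b : Fmt) : b.rn 0 = 0 := b.rn_eq_self_of_mul_ulp 0 (by simp)

/-- Either the grid is at least as coarse as the spacing at `x` and rounding does nothing, or the
result is a multiple of a larger power of two. Hence sums and reductions in FP64 never leave the
grid of their data. -/
theorem rn_onGrid (b : Fmt) {x : ℝ} {e : ℤ} (h : OnGrid e x) : OnGrid e (b.rn x) := by
  by_cases hu : b.ulp x ≤ (2 : ℝ) ^ e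
  · rwa [b.rn_eq_self_of_onGrid h hu]
  · have hu' := (zpow_lt_zpow_iff_right₀ (one_lt_two (α := ℝ))).1 (not_le.1 hu)
    exact OnGrid.mono ⟨_, rfl⟩ hu'.le

theorem ulp_eq_of_minNormal_le (b : Fmt) {x : ℝ} (h : b.minNormal ≤ |x|) :
    b.ulp x = (2 : ℝ) ^ (⌊Real.logb 2 |x|⌋ - (b.prec : ℤ) + 1) := by
  have := le_floor_logb_of_zpow_le h
  unfold Fmt.ulp
  rw [max_eq_left (by omega)]

theorem ulp_le_of_minNormal_le (b : Fmt) {x : ℝ} (h : b.minNormal ≤ |x|) :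
    b.ulp x ≤ 2 * b.u * |x| := by
  have hx : 0 < |x| := lt_of_lt_of_le (by unfold Fmt.minNormal; positivity) h
  rw [b.ulp_eq_of_minNormal_le h]
  have h1 := zpow_floor_logb_le hx
  have : (2 : ℝ) ^ (⌊Real.logb 2 |x|⌋ - (b.prec : ℤ) + 1)
      = 2 * b.u * 2 ^ ⌊Real.logb 2 |x|⌋ := by
    unfold Fmt.u
    rw [sub_add, sub_eq_add_neg, zpow_add₀ two_ne_zero, neg_sub, sub_eq_add_neg,
      zpow_add₀ two_ne_zero, zpow_one]
    ring
  rw [this]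
  have := b.u_pos
  gcongr

theorem ulp_le_of_abs_lt (b : Fmt) {x : ℝ} {e : ℤ} (he : 1 ≤ e) (hq : b.qmin ≤ e - b.prec)
    (h : |x| < (2 : ℝ) ^ e) : b.ulp x ≤ (2 : ℝ) ^ (e - b.prec) := by
  unfold Fmt.ulp
  apply zpow_le_zpow_right₀ one_le_two
  refine max_le ?_ hq
  rcases eq_or_ne x 0 with rfl | hx
  · simp; omega
  · have := floor_logb_lt_of_lt_zpow (abs_pos.2 hx) h
    omega

/-- The grid of spacing `2 ^ qmin` is exact in the subnormal range. -/
theorem abs_rn_sub_le_of_onGrid (b : Fmt) {x : ℝ} (h : OnGrid b.qmin x) :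
    |b.rn x - x| ≤ b.u * |x| := by
  have hu := b.u_pos
  by_cases hn : b.minNormal ≤ |x|
  · have h1 := b.abs_rn_sub_le x
    have h2 := b.ulp_le_of_minNormal_le hn
    linarith
  · rcases eq_or_ne x 0 with rfl | hx
    · simp
    have : b.rn x = x := by
      apply b.rn_eq_self_of_onGrid h
      have := floor_logb_lt_of_lt_zpow (abs_pos.2 hx) (not_le.1 hn)
      unfold Fmt.ulp
      apply zpow_le_zpow_right₀ one_le_two
      exact max_le (by omega) le_rfl
    rw [this, sub_self, abs_zero]
    positivity

/-- For arguments off the subnormal grid: the product with `Pinv`, and the final conversion to FP32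
of a number that may be finer than the FP32 grid. -/
theorem abs_rn_sub_le_add (b : Fmt) (x : ℝ) :
    |b.rn x - x| ≤ b.u * |x| + (2 : ℝ) ^ b.qmin := by
  have hu := b.u_pos
  have h1 := b.abs_rn_sub_le x
  have hq : (0 : ℝ) < 2 ^ b.qmin := by positivity
  rcases eq_or_ne x 0 with rfl | hx
  · simp [hq.le]
  by_cases hn : b.minNormal ≤ |x|
  · have h2 := b.ulp_le_of_minNormal_le hn
    linarith
  · have := floor_logb_lt_of_lt_zpow (abs_pos.2 hx) (not_le.1 hn)
    have h3 : b.ulp x = 2 ^ b.qmin := by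
      unfold Fmt.ulp
      rw [max_eq_right (by omega)]
    have : 0 ≤ b.u * |x| := by positivity
    linarith

theorem rn_eq_self_of_lt (b : Fmt) {x : ℝ} {e : ℤ} (h : OnGrid e x) (he : b.qmin ≤ e)
    (hx : |x| < (2 : ℝ) ^ (e + b.prec)) : b.rn x = x := by
  rcases eq_or_ne x 0 with rfl | hx0
  · simp
  apply b.rn_eq_self_of_onGrid h
  have := floor_logb_lt_of_lt_zpow (abs_pos.2 hx0) hx
  unfold Fmt.ulp
  apply zpow_le_zpow_right₀ one_le_two
  exact max_le (by omega) he

/-! ### Significands and exact scaling by powers of two. -/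

theorem prec_pos (b : Fmt) : 1 ≤ b.prec := by cases b <;> simp [Fmt.prec]

/-- Numbers whose significand fits into the format (the exponent is not restricted). -/
def FitsPrec (b : Fmt) (x : ℝ) : Prop :=
  ∃ M e : ℤ, |M| < 2 ^ b.prec ∧ x = (M : ℝ) * (2 : ℝ) ^ e

/-- Equality has to be allowed because rounding can carry into the next binade; the significand is
then renormalized to ±1. -/
theorem fitsPrec_of_abs_le (b : Fmt) {M : ℤ} (e : ℤ) (hM : |M| ≤ 2 ^ b.prec) :
    b.FitsPrec (M * (2 : ℝ) ^ e) := by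
  rcases hM.lt_or_eq with h | h
  · exact ⟨M, e, h, rfl⟩
  · have hlt : (1 : ℤ) < 2 ^ b.prec := one_lt_pow₀ (by norm_num) (by have := b.prec_pos; omega)
    rcases abs_cases M with ⟨h1, _⟩ | ⟨h1, _⟩
    · refine ⟨1, e + b.prec, by simpa using hlt, ?_⟩
      have hM' : (M : ℝ) = 2 ^ b.prec := by rw [← h1, h]; push_cast; rfl
      rw [hM', zpow_add₀ two_ne_zero, zpow_natCast]; push_cast; ring
    · refine ⟨-1, e + b.prec, by simpa using hlt, ?_⟩
      have hM' : (M : ℝ) = -2 ^ b.prec := by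
        have : M = -2 ^ b.prec := by omega
        rw [this]; push_cast; rfl
      rw [hM', zpow_add₀ two_ne_zero, zpow_natCast]; push_cast; ring

theorem abs_div_ulp_le (b : Fmt) (x : ℝ) : |x / b.ulp x| ≤ 2 ^ b.prec := by
  have hu := b.ulp_pos x
  rcases eq_or_ne x 0 with rfl | hx
  · simp
  rw [abs_div, abs_of_pos hu, div_le_iff₀ hu]
  have h1 := lt_zpow_floor_logb (abs_pos.2 hx)
  refine h1.le.trans ?_
  unfold Fmt.ulp
  rw [← zpow_natCast, ← zpow_add₀ two_ne_zero]
  apply zpow_le_zpow_right₀ one_le_two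
  have := le_max_left (⌊Real.logb 2 |x|⌋ - (b.prec : ℤ) + 1) b.qmin
  omega

theorem rn_fitsPrec (b : Fmt) (x : ℝ) : b.FitsPrec (b.rn x) := by
  apply b.fitsPrec_of_abs_le
  have h1 := b.abs_div_ulp_le x
  have h2 := abs_roundEven_sub_le (x / b.ulp x)
  rw [abs_le] at h1 h2
  rw [← Int.lt_add_one_iff, abs_lt]
  constructor
  · rw [← Int.cast_lt (R := ℝ)]; push_cast; linarith
  · rw [← Int.cast_lt (R := ℝ)]; push_cast; linarith

theorem FitsPrec.zpow_mul {b : Fmt} {x : ℝ} (h : b.FitsPrec x) (e : ℤ) :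
    b.FitsPrec ((2 : ℝ) ^ e * x) := by
  obtain ⟨M, f, hM, rfl⟩ := h
  exact ⟨M, e + f, hM, by rw [zpow_add₀ two_ne_zero]; ring⟩

theorem FitsPrec.rn_eq_self {b : Fmt} {x : ℝ} (h : b.FitsPrec x) (hn : b.NoUnderflow x) :
    b.rn x = x := by
  rcases hn with rfl | hn
  · simp
  have hx : 0 < |x| := lt_of_lt_of_le (by unfold Fmt.minNormal; positivity) hn
  obtain ⟨M, e, hM, hxe⟩ := h
  apply b.rn_eq_self_of_onGrid ⟨M, hxe⟩
  rw [b.ulp_eq_of_minNormal_le hn]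
  have : |x| < (2 : ℝ) ^ (e + b.prec) := by
    rw [hxe, abs_mul, abs_of_pos (by positivity : (0 : ℝ) < 2 ^ e), zpow_add₀ two_ne_zero, mul_comm,
      zpow_natCast]
    have : |(M : ℝ)| < 2 ^ b.prec := by exact_mod_cast hM
    gcongr
  have := floor_logb_lt_of_lt_zpow hx this
  apply zpow_le_zpow_right₀ one_le_two
  omega

/-! ### Directed rounding -/

theorem rd_le (b : Fmt) (x : ℝ) : b.rd x ≤ x := by
  have hu := b.ulp_pos x
  unfold Fmt.rd
  rw [← le_div_iff₀ hu]
  exact Int.floor_le _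

theorem sub_ulp_lt_rd (b : Fmt) (x : ℝ) : x - b.ulp x < b.rd x := by
  have hu := b.ulp_pos x
  unfold Fmt.rd
  have := Int.lt_floor_add_one (x / b.ulp x)
  rw [div_lt_iff₀ hu] at this
  linarith

theorem le_ru (b : Fmt) (x : ℝ) : x ≤ b.ru x := by
  have hu := b.ulp_pos x
  unfold Fmt.ru
  rw [← div_le_iff₀ hu]
  exact Int.le_ceil _

theorem ru_lt_add_ulp (b : Fmt) (x : ℝ) : b.ru x < x + b.ulp x := by
  have hu := b.ulp_pos x
  unfold Fmt.ru
  have := Int.ceil_lt_add_one (x / b.ulp x)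
  have h2 : x / b.ulp x * b.ulp x = x := div_mul_cancel₀ _ hu.ne'
  nlinarith

/-- Needed because the accuracy of `log2f` is assumed only at FP32 numbers. -/
theorem ru_mem_F {x : ℝ} (h1 : 1 ≤ x) (h2 : x < 2 ^ (30 : ℤ)) : fp32.ru x ∈ fp32.F := by
  have hu := fp32.ulp_pos x
  have hle := fp32.abs_div_ulp_le x
  have hx : |x| = x := abs_of_pos (by linarith)
  have h30 := floor_logb_lt_of_lt_zpow (by linarith) h2
  have h0 : 0 ≤ ⌊Real.logb 2 x⌋ := le_floor_logb_of_zpow_le (by simpa using h1)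
  have hM : |⌈x / fp32.ulp x⌉| ≤ 2 ^ 24 := by
    rw [abs_of_nonneg (Int.ceil_nonneg (by positivity)), Int.ceil_le]
    push_cast
    refine (le_abs_self _).trans (hle.trans ?_)
    norm_num [Fmt.prec]
  unfold Fmt.ru
  rw [show fp32.ulp x = (2 : ℝ) ^ (⌊Real.logb 2 x⌋ - 23) by
    unfold Fmt.ulp
    rw [hx]
    congr 1
    simp only [Fmt.prec, Fmt.qmin]
    omega] at *
  rcases hM.lt_or_eq with h | h
  · exact ⟨_, _, h, by simp only [Fmt.qmin]; omega, by simp only [Fmt.qmax]; omega, rfl⟩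
  · rw [abs_of_nonneg (Int.ceil_nonneg (by positivity))] at h
    refine ⟨1, ⌊Real.logb 2 x⌋ + 1, by norm_num [Fmt.prec], by simp only [Fmt.qmin]; omega,
      by simp only [Fmt.qmax]; omega, ?_⟩
    rw [h, show ⌊Real.logb 2 x⌋ + 1 = 24 + (⌊Real.logb 2 x⌋ - 23) by ring, zpow_add₀ two_ne_zero]
    norm_num

end Fmt

/-! ### Floating-point sums of products -/

theorem SumTree.leaves_sum_of_isOrder {N : ℕ} {τ : SumTree (Fin N)} (h : τ.IsOrder)
    (f : Fin N → ℝ) : (τ.leaves.map f).sum = ∑ l, f l := by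
  rw [(h.map f).sum_eq, Fin.sum_univ_def]

theorem SumTree.length_leaves_of_isOrder {N : ℕ} {τ : SumTree (Fin N)} (h : τ.IsOrder) :
    τ.leaves.length = N := by
  rw [List.Perm.length_eq h, List.length_finRange]

theorem SumTree.length_leaves_pos {ι : Type} (τ : SumTree ι) : 1 ≤ τ.leaves.length := by
  induction τ with
  | leaf i => simp [SumTree.leaves]
  | node l r hl hr => simp only [SumTree.leaves, List.length_append]; omega

theorem SumTree.flDot_onGrid {ι : Type} {e : ℤ} {x : ι → ℝ} {y : ι → ℤ} (hx : ∀ i, OnGrid e (x i))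
    (τ : SumTree ι) : OnGrid e (τ.flDot x (fun i => (y i : ℝ))) := by
  induction τ with
  | leaf i => exact Fmt.rn_onGrid _ ((hx i).mul_int _)
  | node l r hl hr => exact Fmt.rn_onGrid _ (hl.add hr)

theorem SumTree.abs_sum_leaves_le {ι : Type} (τ : SumTree ι) (f : ι → ℝ) :
    |(τ.leaves.map f).sum| ≤ (τ.leaves.map fun i => |f i|).sum := by
  induction τ with
  | leaf i => simp [SumTree.leaves]
  | node l r hl hr =>
    simp only [SumTree.leaves, List.map_append, List.sum_append]
    exact (abs_add_le _ _).trans (add_le_add hl hr)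

theorem SumTree.sum_leaves_abs_nonneg {ι : Type} (τ : SumTree ι) (f : ι → ℝ) :
    0 ≤ (τ.leaves.map fun i => |f i|).sum :=
  (abs_nonneg _).trans (τ.abs_sum_leaves_le f)

/-- In any order of summation a term passes through its product rounding and at most n - 1
additions, hence at most n factors 1 + u. The grid hypothesis excludes underflow errors. -/
theorem SumTree.abs_flDot_sub_le {ι : Type} {x : ι → ℝ} {y : ι → ℤ}
    (hx : ∀ i, OnGrid Fmt.fp64.qmin (x i)) (τ : SumTree ι) :
    |τ.flDot x (fun i => (y i : ℝ)) - (τ.leaves.map fun i => x i * y i).sum| ≤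
      ((1 + Fmt.fp64.u) ^ τ.leaves.length - 1) * (τ.leaves.map fun i => |x i * y i|).sum := by
  have hu := Fmt.fp64.u_pos
  induction τ with
  | leaf i =>
    simpa [SumTree.leaves, SumTree.flDot] using
      Fmt.abs_rn_sub_le_of_onGrid .fp64 ((hx i).mul_int (y i))
  | node l r hl hr =>
    have hg := Fmt.abs_rn_sub_le_of_onGrid .fp64
      ((SumTree.flDot_onGrid (y := y) hx l).add (SumTree.flDot_onGrid (y := y) hx r))
    simp only [SumTree.leaves, SumTree.flDot, List.map_append, List.sum_append, List.length_append]
    have al := l.abs_sum_leaves_le fun i => x i * (y i : ℝ)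
    have ar := r.abs_sum_leaves_le fun i => x i * (y i : ℝ)
    have nl := l.sum_leaves_abs_nonneg fun i => x i * (y i : ℝ)
    have nr := r.sum_leaves_abs_nonneg fun i => x i * (y i : ℝ)
    have pl := l.length_leaves_pos
    have pr := r.length_leaves_pos
    generalize (l.leaves.map fun i => x i * (y i : ℝ)).sum = sl at *
    generalize (r.leaves.map fun i => x i * (y i : ℝ)).sum = sr at *
    generalize (l.leaves.map fun i => |x i * (y i : ℝ)|).sum = tl at *
    generalize (r.leaves.map fun i => |x i * (y i : ℝ)|).sum = tr at *
    generalize l.flDot x (fun i => (y i : ℝ)) = fl at *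
    generalize r.flDot x (fun i => (y i : ℝ)) = fr at *
    generalize l.leaves.length = a at *
    generalize r.leaves.length = b at *
    -- The sibling subtree has at least one leaf, which pays for the factor of the new addition.
    have e1 : (1 + Fmt.fp64.u) * (1 + Fmt.fp64.u) ^ a ≤ (1 + Fmt.fp64.u) ^ (a + b) := by
      rw [← pow_succ']; exact pow_le_pow_right₀ (by linarith) (by omega)
    have e2 : (1 + Fmt.fp64.u) * (1 + Fmt.fp64.u) ^ b ≤ (1 + Fmt.fp64.u) ^ (a + b) := by
      rw [← pow_succ']; exact pow_le_pow_right₀ (by linarith) (by omega)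
    generalize Fmt.fp64.u = u at *
    generalize (1 + u) ^ (a + b) = C at *
    generalize (1 + u) ^ a = A at *
    generalize (1 + u) ^ b = B at *
    have f1 : |fl + fr| ≤ A * tl + B * tr := by
      rw [abs_le] at hl hr al ar ⊢
      constructor <;> nlinarith
    have f2 : |Fmt.fp64.rn (fl + fr) - (sl + sr)| ≤
        u * (A * tl + B * tr) + (A - 1) * tl + (B - 1) * tr := by
      have := mul_le_mul_of_nonneg_left f1 hu.le
      rw [abs_le] at hl hr hg ⊢
      constructor <;> linarith
    nlinarith

/-- Each partial sum is a multiple of 2^e below 2^(e + 53) in modulus, hence an FP64 number, so no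
operation rounds. -/
theorem SumTree.flDot_eq_sum {ι : Type} {e : ℤ} (he : Fmt.fp64.qmin ≤ e) {x : ι → ℝ} {y : ι → ℤ}
    (hx : ∀ i, OnGrid e (x i)) (τ : SumTree ι)
    (hs : (τ.leaves.map fun i => |x i * (y i : ℝ)|).sum < (2 : ℝ) ^ (e + 53)) :
    τ.flDot x (fun i => (y i : ℝ)) = (τ.leaves.map fun i => x i * (y i : ℝ)).sum := by
  induction τ with
  | leaf i =>
    simp only [SumTree.leaves, SumTree.flDot, List.map_cons, List.map_nil, List.sum_cons,
      List.sum_nil, add_zero] at hs ⊢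
    exact Fmt.rn_eq_self_of_lt .fp64 ((hx i).mul_int _) he (by simpa [Fmt.prec] using hs)
  | node l r hl hr =>
    have gl := SumTree.flDot_onGrid (y := y) hx l
    have gr := SumTree.flDot_onGrid (y := y) hx r
    simp only [SumTree.leaves, SumTree.flDot, List.map_append, List.sum_append] at hs ⊢
    have al := l.abs_sum_leaves_le fun i => x i * (y i : ℝ)
    have ar := r.abs_sum_leaves_le fun i => x i * (y i : ℝ)
    have nl := l.sum_leaves_abs_nonneg fun i => x i * (y i : ℝ)
    have nr := r.sum_leaves_abs_nonneg fun i => x i * (y i : ℝ)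
    rw [hl (by linarith)] at gl ⊢
    rw [hr (by linarith)] at gr ⊢
    refine Fmt.rn_eq_self_of_lt .fp64 (gl.add gr) he ?_
    refine ((abs_add_le _ _).trans (add_le_add al ar)).trans_lt ?_
    simpa [Fmt.prec] using hs


/-! ### The moduli -/

theorem moduliList_bounds : ∀ i < 49, 29 ≤ moduliList.getD i 1 ∧ moduliList.getD i 1 ≤ 256 := by
  decide +kernel

theorem moduliList_coprime : ∀ i < 49, ∀ j < 49, i ≠ j →
    Nat.Coprime (moduliList.getD i 1) (moduliList.getD j 1) := by
  decide +kernel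

theorem bigP_moduli (N : ℕ) :
    bigP (moduli N) = ((List.range N).map fun i => moduliList.getD i 1).prod := by
  unfold bigP moduli
  rw [Fin.prod_univ_eq_prod_range (fun i => moduliList.getD i 1) N]
  rfl

theorem rho_moduli (N : ℕ) :
    rho (moduli N) = ((List.range N).map fun i => moduliList.getD i 1 / 2).sum := by
  unfold rho moduli
  rw [Fin.sum_univ_eq_sum_range (fun i => moduliList.getD i 1 / 2) N]
  rfl

/-- The product of the first moduli is not slightly above a power of two. -/
theorem bigP_numeric : ∀ N < 50, 2 ≤ N →
    let P := ((List.range N).map fun i => moduliList.getD i 1).prod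
    2 ^ 15 ≤ P ∧ P < 2 ^ 350 ∧ 2 ^ Nat.log2 P * (2 ^ 20 + 1) ≤ P * 2 ^ 20 := by
  decide +kernel

theorem rho_numeric : ∀ N < 50, 2 ≤ N →
    let r := ((List.range N).map fun i => moduliList.getD i 1 / 2).sum
    255 ≤ r ∧ r ≤ 2 ^ 12 := by
  decide +kernel

/-! ### Integer arithmetic -/

theorem castInt_modEq (w : ℕ) (x : ℤ) : castInt w x ≡ x [ZMOD (2 : ℤ) ^ w] := by
  have := @Int.bmod_emod x (2 ^ w)
  unfold castInt Int.ModEq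
  push_cast at this ⊢
  exact this

theorem castInt8_eq {x : ℤ} (h1 : -128 ≤ x) (h2 : x < 128) : castInt 8 x = x :=
  Int.bmod_eq_of_le (by norm_num; omega) (by norm_num; omega)

theorem castInt32_eq {x : ℤ} (h1 : -2 ^ 31 ≤ x) (h2 : x < 2 ^ 31) : castInt 32 x = x :=
  Int.bmod_eq_of_le (by norm_num; omega) (by norm_num; omega)

theorem smod_modEq (x : ℤ) (p : ℕ) : smod x p ≡ x [ZMOD p] := by
  unfold smod
  exact (Int.modEq_iff_dvd.2 ⟨round ((x : ℝ) / (p : ℝ)), by ring⟩)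

theorem smod_bounds (x : ℤ) {p : ℕ} (hp : 0 < p) : -(p : ℤ) ≤ 2 * smod x p ∧ 2 * smod x p < p := by
  have hp' : (0 : ℝ) < p := by exact_mod_cast hp
  have h1 := Int.floor_le ((x : ℝ) / p + 1 / 2)
  have h2 := Int.lt_floor_add_one ((x : ℝ) / p + 1 / 2)
  rw [← round_eq] at h1 h2
  have e : (x : ℝ) / p * p = x := div_mul_cancel₀ _ hp'.ne'
  have h1' := mul_le_mul_of_nonneg_right h1 hp'.le
  have h2' := mul_lt_mul_of_pos_right h2 hp'
  unfold smod
  constructor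
  · rw [← Int.cast_le (R := ℝ)]
    push_cast
    linarith
  · rw [← Int.cast_lt (R := ℝ)]
    push_cast
    linarith

theorem int8Gemm_eq {m k n : ℕ} {X : Matrix (Fin m) (Fin k) ℤ} {Y : Matrix (Fin k) (Fin n) ℤ}
    {i : Fin m} {j : Fin n} (hX : ∀ h, -128 ≤ X i h ∧ X i h < 128)
    (hY : ∀ h, -128 ≤ Y h j ∧ Y h j < 128) :
    int8Gemm X Y i j = castInt 32 (∑ h, X i h * Y h j) := by
  unfold int8Gemm
  congr 1
  refine Finset.sum_congr rfl fun h _ => ?_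
  rw [castInt8_eq (hX h).1 (hX h).2, castInt8_eq (hY h).1 (hY h).2]

theorem abs_sum_mul_le {k : ℕ} {x y : Fin k → ℤ} {c : ℤ} (hc : 0 ≤ c) (hx : ∀ h, |x h| ≤ c)
    (hy : ∀ h, |y h| ≤ c) : |∑ h, x h * y h| ≤ k * (c * c) := by
  refine (Finset.abs_sum_le_sum_abs _ _).trans ?_
  calc ∑ h, |x h * y h| ≤ ∑ _h : Fin k, c * c := Finset.sum_le_sum fun h _ => by
        rw [abs_mul]
        exact mul_le_mul (hx h) (hy h) (abs_nonneg _) hc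
    _ = k * (c * c) := by simp

/-- For p ≤ 255 the residues are at most 127 in modulus and 2^17 · 127² < 2^31, so INT32 does not
overflow. For p = 256 the residue -128 occurs and the sum can reach 2^31, but wrapping modulo 2^32
preserves the class modulo 256. -/
theorem int8Gemm_smod_modEq {m k n : ℕ} (hk : k ≤ 2 ^ 17) {p : ℕ} (hp : 0 < p) (hp' : p ≤ 256)
    (A' : Matrix (Fin m) (Fin k) ℤ) (B' : Matrix (Fin k) (Fin n) ℤ) (i : Fin m) (j : Fin n) :
    int8Gemm (fun i h => smod (A' i h) p) (fun h j => smod (B' h j) p) i j ≡ (A' * B') i j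
      [ZMOD p] := by
  have h0 := congrArg (· % (p : ℤ)) (int8Gemm_eq (X := fun i h => smod (A' i h) p)
    (Y := fun h j => smod (B' h j) p) (i := i) (j := j)
    (fun h => by have := smod_bounds (A' i h) hp; omega)
    (fun h => by have := smod_bounds (B' h j) hp; omega))
  refine Int.ModEq.trans h0 ?_
  have h1 : ∑ h, smod (A' i h) p * smod (B' h j) p ≡ (A' * B') i j [ZMOD p] := by
    rw [Matrix.mul_apply]
    exact Int.ModEq.sum fun h _ => (smod_modEq _ _).mul (smod_modEq _ _)
  refine Int.ModEq.trans ?_ h1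
  rcases hp'.lt_or_eq with hlt | rfl
  · rw [castInt32_eq]
    all_goals
      have := abs_sum_mul_le (k := k) (x := fun h => smod (A' i h) p)
        (y := fun h => smod (B' h j) p) (c := 127) (by norm_num)
        (fun h => by have := smod_bounds (A' i h) hp; rw [abs_le]; omega)
        (fun h => by have := smod_bounds (B' h j) hp; rw [abs_le]; omega)
      rw [abs_le] at this
      have : (k : ℤ) ≤ 2 ^ 17 := by exact_mod_cast hk
      omega
  · exact (castInt_modEq 32 _).of_dvd ⟨2 ^ 24, by norm_num⟩

theorem W_modEq {m k n N : ℕ} (hk : k ≤ 2 ^ 17) {p : Fin N → ℕ} {l : Fin N} (hp : 0 < p l)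
    (hp' : p l ≤ 256) (A' : Matrix (Fin m) (Fin k) ℤ) (B' : Matrix (Fin k) (Fin n) ℤ)
    (i : Fin m) (j : Fin n) :
    W p A' B' l i j ≡ (A' * B') i j [ZMOD p l] ∧ |W p A' B' l i j| ≤ (p l / 2 : ℕ) := by
  unfold W
  have h := smod_bounds
    (int8Gemm (fun i h => smod (A' i h) (p l)) (fun h j => smod (B' h j) (p l)) i j) hp
  rw [castInt8_eq (by omega) (by omega)]
  exact ⟨(smod_modEq _ _).trans (int8Gemm_smod_modEq hk hp hp' A' B' i j), by rw [abs_le]; omega⟩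

/-! ### The weights of the Chinese remainder theorem -/

section Weights

variable {N : ℕ} {p : Fin N → ℕ}

theorem dvd_bigP (p : Fin N → ℕ) (l : Fin N) : p l ∣ bigP p :=
  Finset.dvd_prod_of_mem p (Finset.mem_univ l)

theorem bigP_pos (hp : ∀ l, 0 < p l) : 0 < bigP p := Finset.prod_pos fun l _ => hp l

theorem bigP_div (hp : ∀ l, 0 < p l) (l : Fin N) :
    bigP p / p l = ∏ h ∈ Finset.univ.erase l, p h := by
  unfold bigP
  rw [← Finset.mul_prod_erase Finset.univ p (Finset.mem_univ l), Nat.mul_div_cancel_left _ (hp l)]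

theorem coprime_bigP_div (hp : ∀ l, 0 < p l) (hc : ∀ l h, l ≠ h → (p l).Coprime (p h))
    (l : Fin N) : (bigP p / p l).Coprime (p l) := by
  rw [bigP_div hp]
  exact Nat.Coprime.prod_left fun h hh => hc h l (Finset.ne_of_mem_erase hh)

theorem weight_modEq_one (hp : ∀ l, 0 < p l) (hc : ∀ l h, l ≠ h → (p l).Coprime (p h))
    (l : Fin N) : (weight p l : ℤ) ≡ 1 [ZMOD p l] := by
  have : NeZero (p l) := ⟨(hp l).ne'⟩
  rw [← ZMod.intCast_eq_intCast_iff]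
  unfold weight qInv
  rw [Int.cast_natCast, Nat.cast_mul, Int.cast_one, ZMod.natCast_zmod_val,
    ZMod.coe_mul_inv_eq_one _ (coprime_bigP_div hp hc l)]

theorem dvd_weight (hp : ∀ l, 0 < p l) {l h : Fin N} (hlh : h ≠ l) : p h ∣ weight p l := by
  unfold weight
  rw [bigP_div hp]
  exact (Finset.dvd_prod_of_mem p (Finset.mem_erase.2 ⟨hlh, Finset.mem_univ h⟩)).mul_right _

theorem weight_lt (hp : ∀ l, 0 < p l) (l : Fin N) : weight p l < bigP p := by
  have : NeZero (p l) := ⟨(hp l).ne'⟩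
  have h1 : qInv p l < p l := ZMod.val_lt _
  have h2 : 0 < bigP p / p l := Nat.div_pos (Nat.le_of_dvd (bigP_pos hp) (dvd_bigP p l)) (hp l)
  calc weight p l < bigP p / p l * p l := Nat.mul_lt_mul_of_pos_left h1 h2
    _ = bigP p := Nat.div_mul_cancel (dvd_bigP p l)

theorem weight_pos (hp : ∀ l, 1 < p l) (hc : ∀ l h, l ≠ h → (p l).Coprime (p h)) (l : Fin N) :
    0 < weight p l := by
  by_contra h0
  have := weight_modEq_one (fun l => zero_lt_one.trans (hp l)) hc l
  rw [Nat.eq_zero_of_not_pos h0] at this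
  have h1 := Int.modEq_iff_dvd.1 this
  have h2 : p l ∣ 1 := by
    rw [Nat.cast_zero, sub_zero] at h1
    exact_mod_cast h1
  have := Nat.le_of_dvd one_pos h2
  have := hp l
  omega

/-- Modulo p_h only the term with index h survives, and its weight is 1; coprimality combines the
congruences. -/
theorem exists_sum_weight_mul_eq (hp : ∀ l, 0 < p l) (hc : ∀ l h, l ≠ h → (p l).Coprime (p h))
    {w : Fin N → ℤ} {T : ℤ} (hw : ∀ l, w l ≡ T [ZMOD p l]) :
    ∃ Z : ℤ, ∑ l, (weight p l : ℤ) * w l = T + bigP p * Z := by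
  have h : (bigP p : ℤ) ∣ ∑ l, (weight p l : ℤ) * w l - T := by
    unfold bigP
    push_cast
    apply Fintype.prod_dvd_of_coprime
    · intro l h hlh
      exact Nat.isCoprime_iff_coprime.2 (hc l h hlh)
    · intro h
      apply Int.ModEq.dvd
      rw [← Finset.add_sum_erase _ _ (Finset.mem_univ h)]
      have h1 : (weight p h : ℤ) * w h ≡ 1 * T [ZMOD p h] := (weight_modEq_one hp hc h).mul (hw h)
      have h2 : ∑ l ∈ Finset.univ.erase h, (weight p l : ℤ) * w l ≡ 0 [ZMOD p h] := by
        apply Int.modEq_zero_iff_dvd.2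
        refine Finset.dvd_sum fun l hl => Dvd.dvd.mul_right ?_ _
        exact_mod_cast dvd_weight hp (Finset.ne_of_mem_erase hl).symm
      have := (h1.add h2).symm
      simpa using this
  obtain ⟨Z, hZ⟩ := h
  exact ⟨Z, by linarith⟩

end Weights


/-! ### The scaling exponents -/

theorem u32_eq : Fmt.fp32.u = 1 / 16777216 := by
  norm_num [Fmt.u, Fmt.prec]

/-- The exact quotient is slightly below -(1/2 + 2u) and the spacing there is u, so rounding down
goes all the way to 3u. Only 2u is needed against the error of `log2f`; the surplus keeps T away
from 𝒫/2. -/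
theorem scaleConst_eq : scaleConst = -(1 / 2 + 3 * Fmt.fp32.u) := by
  have hfl : ⌊Real.logb 2 |-(1 / 2 : ℝ) / (1 - 4 * Fmt.fp32.u)|⌋ = -1 := by
    rw [u32_eq]
    apply le_antisymm
    · exact Int.lt_add_one_iff.1 (floor_logb_lt_of_lt_zpow (by norm_num [abs_div])
        (by norm_num [abs_div]))
    · exact le_floor_logb_of_zpow_le (by norm_num [abs_div])
  have hulp : Fmt.fp32.ulp (-(1 / 2 : ℝ) / (1 - 4 * Fmt.fp32.u)) = 1 / 16777216 := by
    unfold Fmt.ulp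
    rw [hfl]
    norm_num [Fmt.prec, Fmt.qmin]
  unfold scaleConst Fmt.rd
  rw [hulp, u32_eq, show ⌊-(1 / 2 : ℝ) / (1 - 4 * (1 / 16777216)) / (1 / 16777216)⌋ = -8388611 by
    rw [Int.floor_eq_iff]; norm_num]
  norm_num

/-- `log2 √((𝒫 - 1) / 2)`. -/
def logHalfP {N : ℕ} (p : Fin N → ℕ) : ℝ := Real.logb 2 ((bigP p : ℝ) - 1) / 2 - 1 / 2

/-- The exponent by which the preliminary scaling is corrected. -/
def shift {N : ℕ} (log2f : ℝ → ℝ) (p : Fin N → ℕ) (d : ℝ) : ℤ :=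
  ⌊Fmt.fp32.rd (scaleConst * log2f d + P' p)⌋

section Shift

variable {N : ℕ} {p : Fin N → ℕ} {log2f : ℝ → ℝ} {d : ℝ}

/-- All roundings go downwards, and (1/2 + 3u)(1 - 4u) = 1/2 + u - 12u² ≥ 1/2 + u/2. -/
theorem shift_le (hlog : IsLog2f log2f) (hd : d ∈ Fmt.fp32.F) (h1 : 1 ≤ d) :
    (shift log2f p d : ℝ) ≤ logHalfP p - (1 / 2 + Fmt.fp32.u / 2) * Real.logb 2 d := by
  have hl := (hlog d hd h1).2
  have hL : 0 ≤ Real.logb 2 d := Real.logb_nonneg one_lt_two h1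
  have h2 := Int.floor_le (Fmt.fp32.rd (scaleConst * log2f d + P' p))
  have h3 := Fmt.fp32.rd_le (scaleConst * log2f d + P' p)
  have h4 : P' p ≤ logHalfP p := Fmt.fp32.rd_le _
  unfold shift
  rw [scaleConst_eq] at *
  rw [u32_eq] at *
  rw [abs_le] at hl
  nlinarith

theorem logHalfP_bounds (h1 : 2 ^ 15 ≤ bigP p) (h2 : bigP p < 2 ^ 350) :
    0 ≤ logHalfP p ∧ logHalfP p ≤ 175 := by
  have h1' : (2 : ℝ) ^ 15 ≤ bigP p := by exact_mod_cast h1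
  have h2' : (bigP p : ℝ) < 2 ^ 350 := by exact_mod_cast h2
  have hp : (0 : ℝ) < bigP p - 1 := by linarith
  unfold logHalfP
  have e1 : 1 ≤ Real.logb 2 ((bigP p : ℝ) - 1) := by
    rw [Real.le_logb_iff_rpow_le one_lt_two hp]
    rw [Real.rpow_one]
    linarith
  have e2 : Real.logb 2 ((bigP p : ℝ) - 1) ≤ (350 : ℕ) := by
    rw [Real.logb_le_iff_le_rpow one_lt_two hp, Real.rpow_natCast]
    exact (sub_one_lt _).le.trans h2'.le
  push_cast at e2
  constructor <;> linarith

/-- The floor costs at most 1; the other 1/4 generously covers two roundings of size 2^(-16) and the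
error of the logarithm. -/
theorem le_shift (hlog : IsLog2f log2f) (hd : d ∈ Fmt.fp32.F) (hd1 : 1 ≤ d)
    (hd30 : Real.logb 2 d ≤ 30) (h1 : 2 ^ 15 ≤ bigP p) (h2 : bigP p < 2 ^ 350) :
    logHalfP p - Real.logb 2 d / 2 - 5 / 4 ≤ shift log2f p d := by
  have hl := (hlog d hd hd1).2
  have hL : 0 ≤ Real.logb 2 d := Real.logb_nonneg one_lt_two hd1
  have hP := logHalfP_bounds h1 h2
  have hPrd : P' p ≤ logHalfP p := Fmt.fp32.rd_le _
  have hPulp : Fmt.fp32.ulp (logHalfP p) ≤ (2 : ℝ) ^ ((8 : ℤ) - 24) :=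
    Fmt.fp32.ulp_le_of_abs_lt (by norm_num) (by norm_num [Fmt.prec, Fmt.qmin])
      (by rw [abs_lt]; norm_num; constructor <;> linarith)
  have hPlt : logHalfP p - Fmt.fp32.ulp (logHalfP p) < P' p := Fmt.fp32.sub_ulp_lt_rd _
  unfold shift
  have hfl := Int.lt_floor_add_one (Fmt.fp32.rd (scaleConst * log2f d + P' p))
  have hlt := Fmt.fp32.sub_ulp_lt_rd (scaleConst * log2f d + P' p)
  have hy : |scaleConst * log2f d + P' p| < (2 : ℝ) ^ (8 : ℤ) := by
    rw [scaleConst_eq, u32_eq] at *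
    rw [abs_le] at hl
    rw [abs_lt]
    norm_num at *
    constructor <;> linarith
  have hyulp : Fmt.fp32.ulp (scaleConst * log2f d + P' p) ≤ (2 : ℝ) ^ ((8 : ℤ) - 24) :=
    Fmt.fp32.ulp_le_of_abs_lt (by norm_num) (by norm_num [Fmt.prec, Fmt.qmin]) hy
  rw [show (2 : ℝ) ^ ((8 : ℤ) - 24) = 1 / 65536 by norm_num] at hPulp hyulp
  rw [abs_le] at hl
  have hc : scaleConst * log2f d ≥ -(Real.logb 2 d / 2) - 1 / 16 := by
    rw [scaleConst_eq, u32_eq] at *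
    linarith
  linarith

end Shift

/-! ### Preliminary scaling -/

theorem abs_le_iSup {k : ℕ} (v : Fin k → ℝ) (h : Fin k) : |v h| ≤ ⨆ h, |v h| :=
  le_ciSup (f := fun h => |v h|) (Set.finite_range _).bddAbove h

theorem zpow_mul_abs_lt {k : ℕ} {v : Fin k → ℝ} (hv : ∃ h, v h ≠ 0) (h : Fin k) :
    (2 : ℝ) ^ (5 - ⌊Real.logb 2 (⨆ h, |v h|)⌋) * |v h| < 64 := by
  obtain ⟨h0, hh0⟩ := hv
  have hpos : 0 < ⨆ h, |v h| := (abs_pos.2 hh0).trans_le (abs_le_iSup v h0)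
  have h1 := (abs_le_iSup v h).trans_lt (lt_zpow_floor_logb hpos)
  calc (2 : ℝ) ^ (5 - ⌊Real.logb 2 (⨆ h, |v h|)⌋) * |v h|
      < (2 : ℝ) ^ (5 - ⌊Real.logb 2 (⨆ h, |v h|)⌋) *
        (2 : ℝ) ^ (⌊Real.logb 2 (⨆ h, |v h|)⌋ + 1) := by gcongr
    _ = 64 := by
      rw [← zpow_add₀ two_ne_zero, show 5 - ⌊Real.logb 2 (⨆ h, |v h|)⌋ +
        (⌊Real.logb 2 (⨆ h, |v h|)⌋ + 1) = 6 by ring]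
      norm_num

section Prelim

variable {m k n : ℕ} {A : Matrix (Fin m) (Fin k) ℝ} {B : Matrix (Fin k) (Fin n) ℝ}

theorem Abar_bounds {i : Fin m} (hv : ∃ h, A i h ≠ 0) (h : Fin k) :
    0 ≤ Abar A i h ∧ Abar A i h ≤ 64 := by
  refine ⟨Int.ceil_nonneg (by positivity), Int.ceil_le.2 ?_⟩
  exact_mod_cast (zpow_mul_abs_lt hv h).le

theorem Bbar_bounds {j : Fin n} (hv : ∃ h, B h j ≠ 0) (h : Fin k) :
    0 ≤ Bbar B h j ∧ Bbar B h j ≤ 64 := by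
  refine ⟨Int.ceil_nonneg (by positivity), Int.ceil_le.2 ?_⟩
  rw [mul_comm]
  exact_mod_cast (zpow_mul_abs_lt (v := fun h => B h j) hv h).le

theorem Cbar_eq (hk : k ≤ 2 ^ 17) {i : Fin m} {j : Fin n} (hi : ∃ h, A i h ≠ 0)
    (hj : ∃ h, B h j ≠ 0) :
    Cbar A B i j = ∑ h, Abar A i h * Bbar B h j ∧ 0 ≤ Cbar A B i j ∧ Cbar A B i j ≤ 2 ^ 29 := by
  have ha := Abar_bounds hi
  have hb := Bbar_bounds hj
  have h0 : 0 ≤ ∑ h, Abar A i h * Bbar B h j :=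
    Finset.sum_nonneg fun h _ => mul_nonneg (ha h).1 (hb h).1
  have h1 := abs_sum_mul_le (k := k) (x := fun h => Abar A i h) (y := fun h => Bbar B h j)
    (c := 64) (by norm_num) (fun h => by rw [abs_of_nonneg (ha h).1]; exact (ha h).2)
    (fun h => by rw [abs_of_nonneg (hb h).1]; exact (hb h).2)
  rw [abs_of_nonneg h0] at h1
  have hk' : (k : ℤ) ≤ 2 ^ 17 := by exact_mod_cast hk
  have e : Cbar A B i j = ∑ h, Abar A i h * Bbar B h j := by
    unfold Cbar
    rw [int8Gemm_eq (fun h => by have := ha h; omega) (fun h => by have := hb h; omega)]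
    exact castInt32_eq (by omega) (by omega)
  rw [e]
  exact ⟨rfl, h0, by omega⟩

theorem scaled_sum_le_Cbar (hk : k ≤ 2 ^ 17) {i : Fin m} {j : Fin n} (hi : ∃ h, A i h ≠ 0)
    (hj : ∃ h, B h j ≠ 0) :
    (2 : ℝ) ^ mu' A i * (2 : ℝ) ^ nu' B j * ∑ h, |A i h| * |B h j| ≤ Cbar A B i j := by
  rw [(Cbar_eq hk hi hj).1]
  push_cast
  rw [Finset.mul_sum]
  refine Finset.sum_le_sum fun h _ => ?_
  calc (2 : ℝ) ^ mu' A i * (2 : ℝ) ^ nu' B j * (|A i h| * |B h j|)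
      = ((2 : ℝ) ^ mu' A i * |A i h|) * (|B h j| * (2 : ℝ) ^ nu' B j) := by ring
    _ ≤ _ := mul_le_mul (Int.le_ceil _) (Int.le_ceil _) (by positivity)
      (by exact_mod_cast (Abar_bounds hi h).1)

theorem one_le_Cbar (hk : k ≤ 2 ^ 17) {i : Fin m} {j : Fin n} (h : ∃ h, A i h * B h j ≠ 0) :
    1 ≤ Cbar A B i j := by
  obtain ⟨h, hh⟩ := h
  have ha : A i h ≠ 0 := left_ne_zero_of_mul hh
  have hb : B h j ≠ 0 := right_ne_zero_of_mul hh
  have h1 := scaled_sum_le_Cbar hk ⟨h, ha⟩ ⟨h, hb⟩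
  have h2 : 0 < ∑ h, |A i h| * |B h j| :=
    Finset.sum_pos' (fun h _ => by positivity) ⟨h, Finset.mem_univ h, by positivity⟩
  have h3 : (0 : ℝ) < Cbar A B i j := lt_of_lt_of_le (by positivity) h1
  exact_mod_cast h3

end Prelim

/-- Rounding the maximum of integers in the range of `C̅` upwards. -/
theorem iSup_ru_bounds {n : ℕ} {c : Fin n → ℤ} (h0 : ∀ h, 0 ≤ c h) (h29 : ∀ h, c h ≤ 2 ^ 29)
    (h1 : ∃ h, 1 ≤ c h) :
    (⨆ h, Fmt.fp32.ru (c h)) ∈ Fmt.fp32.F ∧ 1 ≤ (⨆ h, (c h : ℝ)) ∧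
      (⨆ h, (c h : ℝ)) ≤ ⨆ h, Fmt.fp32.ru (c h) ∧
      Real.logb 2 (⨆ h, Fmt.fp32.ru (c h)) ≤ Real.logb 2 (⨆ h, (c h : ℝ)) + 1 / 8 ∧
      Real.logb 2 (⨆ h, Fmt.fp32.ru (c h)) ≤ 30 := by
  obtain ⟨j, hj⟩ := h1
  have : Nonempty (Fin n) := ⟨j⟩
  have hc : ∀ h, (c h : ℝ) ≤ ⨆ h, (c h : ℝ) := fun h =>
    le_ciSup (f := fun h => (c h : ℝ)) (Set.finite_range _).bddAbove h
  have hr : ∀ h, Fmt.fp32.ru (c h) ≤ ⨆ h, Fmt.fp32.ru (c h) := fun h =>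
    le_ciSup (f := fun h => Fmt.fp32.ru (c h)) (Set.finite_range _).bddAbove h
  have hj' : (1 : ℝ) ≤ c j := by exact_mod_cast hj
  have hM := hj'.trans (hc j)
  have hle : (⨆ h, (c h : ℝ)) ≤ ⨆ h, Fmt.fp32.ru (c h) :=
    ciSup_le fun h => (Fmt.fp32.le_ru _).trans (hr h)
  obtain ⟨l, hl⟩ := exists_eq_ciSup_of_finite (f := fun h => Fmt.fp32.ru (c h))
  -- The maximizing entry is nonzero, so it lies in the normal range and its upward rounding has a
  -- relative error bound.
  have hcl : 1 ≤ c l := by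
    by_contra hcon
    have : c l = 0 := by have := h0 l; omega
    rw [this] at hl
    rw [Int.cast_zero, show Fmt.fp32.ru 0 = 0 by simp [Fmt.ru]] at hl
    linarith
  have hcl' : (1 : ℝ) ≤ c l := by exact_mod_cast hcl
  have h29' : (c l : ℝ) ≤ 2 ^ 29 := by exact_mod_cast h29 l
  have hab : |(c l : ℝ)| = c l := abs_of_pos (by linarith)
  have hulp := Fmt.fp32.ulp_le_of_minNormal_le (x := (c l : ℝ)) (by
    rw [hab]; exact le_trans (by norm_num [Fmt.minNormal, Fmt.qmin, Fmt.prec]) hcl')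
  have hlt := Fmt.fp32.ru_lt_add_ulp (c l)
  rw [hab, u32_eq] at hulp
  have hD : (⨆ h, Fmt.fp32.ru (c h)) ≤ (1 + 1 / 8388608) * ⨆ h, (c h : ℝ) := by
    rw [← hl]; linarith [hc l]
  have hDpos : 0 < ⨆ h, Fmt.fp32.ru (c h) := by linarith
  refine ⟨?_, hM, hle, ?_, ?_⟩
  · rw [← hl]
    exact Fmt.ru_mem_F hcl' (by norm_num at h29' ⊢; linarith)
  · have h8 : Real.logb 2 (1 + 1 / 8388608 : ℝ) ≤ 1 / 8 := by
      have : 8 * Real.logb 2 (1 + 1 / 8388608 : ℝ) ≤ 1 := by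
        have h := Real.logb_pow 2 (1 + 1 / 8388608 : ℝ) 8
        push_cast at h
        rw [← h, Real.logb_le_iff_le_rpow one_lt_two (by norm_num)]
        norm_num
      linarith
    calc Real.logb 2 (⨆ h, Fmt.fp32.ru (c h))
        ≤ Real.logb 2 ((1 + 1 / 8388608) * ⨆ h, (c h : ℝ)) :=
          Real.logb_le_logb_of_le one_lt_two hDpos hD
      _ = Real.logb 2 (1 + 1 / 8388608 : ℝ) + Real.logb 2 (⨆ h, (c h : ℝ)) :=
          Real.logb_mul (by norm_num) (by linarith)
      _ ≤ _ := by linarith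
  · rw [Real.logb_le_iff_le_rpow one_lt_two hDpos, ← hl,
      show (30 : ℝ) = ((30 : ℕ) : ℝ) by norm_num, Real.rpow_natCast]
    norm_num at h29' ⊢
    linarith

/-! ### The scaled and truncated matrices -/

theorem abs_trunc_sub_le (x : ℝ) : |(trunc x : ℝ) - x| ≤ 1 := by
  unfold trunc
  split_ifs
  · rw [abs_le]; constructor <;> linarith [Int.floor_le x, Int.lt_floor_add_one x]
  · rw [abs_le]; constructor <;> linarith [Int.le_ceil x, Int.ceil_lt_add_one x]

theorem abs_trunc_le (x : ℝ) : |(trunc x : ℝ)| ≤ |x| := by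
  unfold trunc
  split_ifs with h
  · rw [abs_of_nonneg (by exact_mod_cast Int.floor_nonneg.2 h), abs_of_nonneg h]
    exact Int.floor_le x
  · have h := not_le.1 h
    have : ⌈x⌉ ≤ 0 := Int.ceil_le.2 (by simpa using h.le)
    rw [abs_of_nonpos (by exact_mod_cast this), abs_of_neg h]
    linarith [Int.le_ceil x]

/-- The relevant properties of the scaling exponents and of the scaled matrices. -/
structure ScalingSpec {m k n N : ℕ} (log2f : ℝ → ℝ) (p : Fin N → ℕ)
    (A : Matrix (Fin m) (Fin k) ℝ) (B : Matrix (Fin k) (Fin n) ℝ) (i : Fin m) (j : Fin n) :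
    Prop where
  zpow_mu_le : (2 : ℝ) ^ (-mu A B log2f p i) ≤
    tConst p * (2 : ℝ) ^ alpha' A B i * (2 : ℝ) ^ (-(1 / 2 : ℝ))
  zpow_nu_le : (2 : ℝ) ^ (-nu A B log2f p j) ≤
    tConst p * (2 : ℝ) ^ beta' A B j * (2 : ℝ) ^ (-(1 / 2 : ℝ))
  abs_prod_le : |(((Aint A B log2f p * Bint A B log2f p) i j : ℤ) : ℝ)| ≤
    (bigP p : ℝ) * (1 / 2 - 1 / 2 ^ 26)

theorem tConst_eq {N : ℕ} {p : Fin N → ℕ} (h1 : 2 ^ 15 ≤ bigP p) :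
    tConst p = (2 : ℝ) ^ (-3 - logHalfP p) := by
  have h1' : (2 : ℝ) ^ 15 ≤ bigP p := by exact_mod_cast h1
  have hp : (0 : ℝ) < bigP p - 1 := by linarith
  unfold tConst
  have : (2 : ℝ) ^ 5 * ((bigP p : ℝ) - 1) = (2 : ℝ) ^ (2 * (3 + logHalfP p)) := by
    rw [show 2 * (3 + logHalfP p) = (5 : ℕ) + Real.logb 2 ((bigP p : ℝ) - 1) by
      unfold logHalfP; push_cast; ring,
      Real.rpow_add two_pos, Real.rpow_natCast, Real.rpow_logb two_pos (by norm_num) hp]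
  rw [this, mul_comm (2 : ℝ) (3 + _), Real.rpow_mul two_pos.le, Real.rpow_two,
    Real.sqrt_sq (by positivity),
    show -3 - logHalfP p = -(3 + logHalfP p) by ring, Real.rpow_neg two_pos.le, one_div]

/-- Since t = 2^(-3 - `logHalfP p`), the 5 in μ' leaves a slack of 2 in the exponent. A loss of 3/2
in the shift uses up all but the factor 2^(-1/2). -/
theorem zpow_neg_le_of_le_shift {N : ℕ} {p : Fin N → ℕ} (h1 : 2 ^ 15 ≤ bigP p) {a s : ℤ}
    {M : ℝ} (hs : logHalfP p - M / 2 - 3 / 2 ≤ s) :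
    (2 : ℝ) ^ (-(5 - a + s)) ≤ tConst p * (2 : ℝ) ^ ((a : ℝ) + M / 2) *
      (2 : ℝ) ^ (-(1 / 2 : ℝ)) := by
  rw [tConst_eq h1, ← Real.rpow_add two_pos, ← Real.rpow_add two_pos, ← Real.rpow_intCast]
  apply Real.rpow_le_rpow_of_exponent_le one_le_two
  push_cast
  linarith

/-- For c ≥ 2 the extra u · log2 c ≥ u in the exponent gives a factor 2^(-u). For c = 1 the
logarithm vanishes and gives no margin; instead 2^(s+1) is a power of two below P, and `hgap`
separates P from it. -/
theorem scaled_le {P : ℕ} (hP : 2 ^ 15 ≤ P) (hgap : 2 ^ Nat.log2 P * (2 ^ 20 + 1) ≤ P * 2 ^ 20)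
    {s : ℤ} {c : ℤ} (hc : 1 ≤ c)
    (hs : (s : ℝ) ≤ Real.logb 2 ((P : ℝ) - 1) - 1 - (1 + Fmt.fp32.u) * Real.logb 2 c) :
    (2 : ℝ) ^ s * c ≤ P * (1 / 2 - 1 / 2 ^ 26) := by
  have h1' : (2 : ℝ) ^ 15 ≤ P := by exact_mod_cast hP
  have hp : (0 : ℝ) < P - 1 := by linarith
  have hu := Fmt.fp32.u_pos
  rcases hc.lt_or_eq with hc2 | rfl
  · have hc2' : (2 : ℝ) ≤ c := by exact_mod_cast hc2
    have hl : 1 ≤ Real.logb 2 c := by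
      rw [Real.le_logb_iff_rpow_le one_lt_two (by linarith)]; simpa using hc2'
    have e1 : (2 : ℝ) ^ s * c ≤ 2 ^ (Real.logb 2 ((P : ℝ) - 1) - 1 - Fmt.fp32.u) := by
      have : (2 : ℝ) ^ s * c = 2 ^ ((s : ℝ) + Real.logb 2 c) := by
        rw [Real.rpow_add two_pos, Real.rpow_intCast, Real.rpow_logb two_pos (by norm_num)
          (by linarith)]
      rw [this]
      apply Real.rpow_le_rpow_of_exponent_le one_le_two
      nlinarith
    rw [Real.rpow_sub two_pos, Real.rpow_sub two_pos, Real.rpow_one,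
      Real.rpow_logb two_pos (by norm_num) hp] at e1
    -- The slope 3/5 is below log 2 and above 1/2, the latter being what the margin 2^(-26) = u/4 on
    -- top of 1/2 requires.
    have e2 : 1 + Fmt.fp32.u * (3 / 5) ≤ (2 : ℝ) ^ Fmt.fp32.u := by
      rw [Real.rpow_def_of_pos two_pos]
      have := Real.add_one_le_exp (Real.log 2 * Fmt.fp32.u)
      nlinarith [Real.log_two_gt_d9]
    refine e1.trans ?_
    rw [div_le_iff₀ (by positivity)]
    have e3 := mul_le_mul_of_nonneg_left e2
      (show (0 : ℝ) ≤ P * (1 / 2 - 1 / 2 ^ 26) by norm_num)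
    refine le_trans ?_ e3
    rw [u32_eq]
    linarith
  · simp only [Int.cast_one, Real.logb_one, mul_zero, sub_zero, mul_one] at hs ⊢
    have hlt : (2 : ℝ) ^ (s + 1) < 2 ^ ((Nat.log2 P + 1 : ℕ) : ℤ) := by
      have e1 : (2 : ℝ) ^ (s + 1) ≤ P - 1 := by
        rw [← Real.rpow_intCast, ← Real.le_logb_iff_rpow_le one_lt_two hp]
        push_cast
        linarith
      have e2 : (P : ℝ) < 2 ^ (Nat.log2 P + 1) := by exact_mod_cast Nat.lt_log2_self
      rw [zpow_natCast]
      linarith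
    have hlt' := (zpow_lt_zpow_iff_right₀ (one_lt_two (α := ℝ))).1 hlt
    have e3 : (2 : ℝ) ^ (s + 1) ≤ 2 ^ ((Nat.log2 P : ℕ) : ℤ) :=
      zpow_le_zpow_right₀ one_le_two (by omega)
    rw [zpow_natCast, zpow_add₀ two_ne_zero, zpow_one] at e3
    have e4 : (2 : ℝ) ^ Nat.log2 P * (2 ^ 20 + 1) ≤ P * 2 ^ 20 := by exact_mod_cast hgap
    norm_num at e4 ⊢
    linarith

theorem scalingSpec {m k n N : ℕ} {log2f : ℝ → ℝ} {p : Fin N → ℕ}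
    {A : Matrix (Fin m) (Fin k) ℝ} {B : Matrix (Fin k) (Fin n) ℝ} (hk : k ≤ 2 ^ 17)
    (hlog : IsLog2f log2f) (hrow : ∀ i, ∃ j h, A i h * B h j ≠ 0)
    (hcol : ∀ j, ∃ i h, A i h * B h j ≠ 0) (hP15 : 2 ^ 15 ≤ bigP p) (hP350 : bigP p < 2 ^ 350)
    (hgap : 2 ^ Nat.log2 (bigP p) * (2 ^ 20 + 1) ≤ bigP p * 2 ^ 20) (i : Fin m) (j : Fin n) :
    ScalingSpec log2f p A B i j := by
  have hA : ∀ i, ∃ h, A i h ≠ 0 := fun i => by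
    obtain ⟨j, h, hh⟩ := hrow i
    exact ⟨h, left_ne_zero_of_mul hh⟩
  have hB : ∀ j, ∃ h, B h j ≠ 0 := fun j => by
    obtain ⟨i, h, hh⟩ := hcol j
    exact ⟨h, right_ne_zero_of_mul hh⟩
  have hC : ∀ i j, 0 ≤ Cbar A B i j ∧ Cbar A B i j ≤ 2 ^ 29 := fun i j =>
    (Cbar_eq hk (hA i) (hB j)).2
  obtain ⟨ri, rM, rD, rlog, r30⟩ := iSup_ru_bounds (c := fun h => Cbar A B i h)
    (fun h => (hC i h).1) (fun h => (hC i h).2)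
    (by obtain ⟨j, hj⟩ := hrow i; exact ⟨j, one_le_Cbar hk hj⟩)
  obtain ⟨si, sM, sD, slog, s30⟩ := iSup_ru_bounds (c := fun h => Cbar A B h j)
    (fun h => (hC h j).1) (fun h => (hC h j).2)
    (by obtain ⟨i, hi⟩ := hcol j; exact ⟨i, one_le_Cbar hk hi⟩)
  have hmu : mu A B log2f p i = mu' A i + shift log2f p (⨆ h, Fmt.fp32.ru (Cbar A B i h)) := rfl
  have hnu : nu A B log2f p j = nu' B j + shift log2f p (⨆ h, Fmt.fp32.ru (Cbar A B h j)) := rfl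
  have r1 := le_shift hlog ri (rM.trans rD) r30 hP15 hP350
  have s1 := le_shift hlog si (sM.trans sD) s30 hP15 hP350
  have r2 := shift_le (p := p) hlog ri (rM.trans rD)
  have s2 := shift_le (p := p) hlog si (sM.trans sD)
  refine ⟨?_, ?_, ?_⟩
  · rw [hmu]
    exact zpow_neg_le_of_le_shift hP15 (by linarith)
  · rw [hnu]
    exact zpow_neg_le_of_le_shift hP15 (by linarith)
  · have hij := hC i j
    have e1 : |(((Aint A B log2f p * Bint A B log2f p) i j : ℤ) : ℝ)| ≤
        (2 : ℝ) ^ (shift log2f p (⨆ h, Fmt.fp32.ru (Cbar A B i h)) +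
          shift log2f p (⨆ h, Fmt.fp32.ru (Cbar A B h j))) * Cbar A B i j := by
      have h1 := scaled_sum_le_Cbar hk (hA i) (hB j)
      rw [Matrix.mul_apply]
      push_cast
      calc |∑ h, (Aint A B log2f p i h : ℝ) * (Bint A B log2f p h j : ℝ)|
          ≤ ∑ h, |(Aint A B log2f p i h : ℝ) * (Bint A B log2f p h j : ℝ)| :=
            Finset.abs_sum_le_sum_abs _ _
        _ ≤ ∑ h, (2 : ℝ) ^ mu A B log2f p i * (2 : ℝ) ^ nu A B log2f p j *
              (|A i h| * |B h j|) := by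
            refine Finset.sum_le_sum fun h _ => ?_
            rw [abs_mul]
            have ha : |(Aint A B log2f p i h : ℝ)| ≤ (2 : ℝ) ^ mu A B log2f p i * |A i h| := by
              refine (abs_trunc_le _).trans_eq ?_
              rw [abs_mul, abs_of_pos (by positivity)]
            have hb : |(Bint A B log2f p h j : ℝ)| ≤ |B h j| * (2 : ℝ) ^ nu A B log2f p j := by
              refine (abs_trunc_le _).trans_eq ?_
              rw [abs_mul, abs_of_pos (by positivity : (0 : ℝ) < 2 ^ nu A B log2f p j)]
            refine (mul_le_mul ha hb (abs_nonneg _) (by positivity)).trans_eq ?_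
            ring
        _ = (2 : ℝ) ^ (shift log2f p (⨆ h, Fmt.fp32.ru (Cbar A B i h)) +
              shift log2f p (⨆ h, Fmt.fp32.ru (Cbar A B h j))) *
            ((2 : ℝ) ^ mu' A i * (2 : ℝ) ^ nu' B j * ∑ h, |A i h| * |B h j|) := by
            rw [← Finset.mul_sum, hmu, hnu]
            simp only [zpow_add₀ (two_ne_zero (α := ℝ))]
            ring
        _ ≤ _ := by gcongr
    refine e1.trans ?_
    rcases hij.1.lt_or_eq with hpos | h0
    · apply scaled_le hP15 hgap (by omega)
      have c1 : (1 : ℝ) ≤ Cbar A B i j := by exact_mod_cast hpos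
      -- The entry is bounded by both its row and its column maximum, so the two halves of the
      -- logarithm add up to a full log2 c̅_ij.
      have ci : Real.logb 2 (Cbar A B i j) ≤ Real.logb 2 (⨆ h, Fmt.fp32.ru (Cbar A B i h)) :=
        Real.logb_le_logb_of_le one_lt_two (by linarith) (le_trans
          (le_ciSup (f := fun h => (Cbar A B i h : ℝ)) (Set.finite_range _).bddAbove j) rD)
      have cj : Real.logb 2 (Cbar A B i j) ≤ Real.logb 2 (⨆ h, Fmt.fp32.ru (Cbar A B h j)) :=
        Real.logb_le_logb_of_le one_lt_two (by linarith) (le_trans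
          (le_ciSup (f := fun h => (Cbar A B h j : ℝ)) (Set.finite_range _).bddAbove i) sD)
      have hL : Real.logb 2 ((bigP p : ℝ) - 1) = 2 * logHalfP p + 1 := by
        unfold logHalfP; ring
      rw [hL, u32_eq] at *
      push_cast
      linarith
    · rw [← h0]
      have : (0 : ℝ) ≤ bigP p := by positivity
      norm_num


/-! ### The reconstruction by the Chinese remainder theorem -/

theorem u64_eq : Fmt.fp64.u = 1 / 9007199254740992 := by
  norm_num [Fmt.u, Fmt.prec]

theorem one_add_u64_pow_le {n : ℕ} (hn : n ≤ 49) :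
    (1 + Fmt.fp64.u) ^ n - 1 ≤ (n + 1) * Fmt.fp64.u := by
  have h : ∀ n : ℕ, n ≤ 49 → (1 + Fmt.fp64.u) ^ n ≤ 1 + 65 / 64 * n * Fmt.fp64.u := by
    intro n
    induction n with
    | zero => simp
    | succ n ih =>
      intro hn
      have hn' : (n : ℝ) ≤ 48 := by exact_mod_cast (by omega : n ≤ 48)
      have hu := Fmt.fp64.u_pos
      rw [pow_succ]
      refine (mul_le_mul_of_nonneg_right (ih (by omega)) (by linarith)).trans ?_
      rw [u64_eq]
      push_cast
      linarith
  have h1 := h n hn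
  have h2 : (n : ℝ) ≤ 49 := by exact_mod_cast hn
  have hu := Fmt.fp64.u_pos
  nlinarith

theorem round_eq_of_abs_sub_lt {x : ℝ} {z : ℤ} (h : |x - z| < 1 / 2) : round x = z := by
  rw [abs_lt] at h
  rw [round_eq, Int.floor_eq_iff]
  constructor <;> linarith

/-- The moduli are admissible and the residues `w` of `T` are reduced. -/
structure CRTData {N : ℕ} (p : Fin N → ℕ) (T : ℤ) (w : Fin N → ℤ) (Z : ℤ) : Prop where
  two_le : 2 ≤ N
  le_49 : N ≤ 49
  P_ge : 2 ^ 15 ≤ bigP p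
  P_lt : bigP p < 2 ^ 350
  rho_ge : 255 ≤ rho p
  rho_le : rho p ≤ 2 ^ 12
  weight_pos : ∀ l, 0 < weight p l
  weight_lt : ∀ l, weight p l < bigP p
  abs_T_le : |(T : ℝ)| ≤ (bigP p : ℝ) * (1 / 2 - 1 / 2 ^ 26)
  abs_w_le : ∀ l, |w l| ≤ (p l / 2 : ℕ)
  sum_eq : ∑ l, (weight p l : ℤ) * w l = T + bigP p * Z

namespace CRTData

variable {N : ℕ} {p : Fin N → ℕ} {T : ℤ} {w : Fin N → ℤ} {Z : ℤ}

theorem sum_eq_real (D : CRTData p T w Z) : ∑ l, (weight p l : ℝ) * w l = T + bigP p * Z := by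
  exact_mod_cast D.sum_eq

theorem P_pos (D : CRTData p T w Z) : (0 : ℝ) < bigP p := by
  have := D.P_ge
  exact_mod_cast (by omega : 0 < bigP p)

theorem rho_ge_real (D : CRTData p T w Z) : (255 : ℝ) ≤ rho p := by exact_mod_cast D.rho_ge

theorem rho_le_real (D : CRTData p T w Z) : (rho p : ℝ) ≤ 4096 := by exact_mod_cast D.rho_le

theorem sum_abs_le (D : CRTData p T w Z) {f : Fin N → ℝ} {c : ℝ} (hf : ∀ l, |f l| ≤ c) :
    ∑ l, |f l * w l| ≤ c * rho p := by
  unfold rho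
  push_cast
  rw [Finset.mul_sum]
  refine Finset.sum_le_sum fun l _ => ?_
  rw [abs_mul]
  refine mul_le_mul (hf l) ?_ (abs_nonneg _) ((abs_nonneg _).trans (hf l))
  have h : ((|w l| : ℤ) : ℝ) ≤ ((p l / 2 : ℕ) : ℤ) := Int.cast_le.2 (D.abs_w_le l)
  rwa [Int.cast_abs, Int.cast_natCast] at h

theorem abs_sum_le (D : CRTData p T w Z) {f : Fin N → ℝ} {c : ℝ} (hf : ∀ l, |f l| ≤ c) :
    |∑ l, f l * w l| ≤ c * rho p :=
  (Finset.abs_sum_le_sum_abs _ _).trans (D.sum_abs_le hf)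

theorem abs_weight_le (D : CRTData p T w Z) (l : Fin N) : |(weight p l : ℝ)| ≤ bigP p := by
  rw [Nat.abs_cast]
  exact_mod_cast (D.weight_lt l).le

/-- The weighted sum is at most 𝒫ρ and T at most 𝒫/2 in modulus. -/
theorem abs_Z_le (D : CRTData p T w Z) : |(Z : ℝ)| ≤ rho p + 1 := by
  have hP := D.P_pos
  have h1 := D.abs_sum_le D.abs_weight_le
  rw [D.sum_eq_real] at h1
  have h2 := D.abs_T_le
  have h3 : (bigP p : ℝ) * |(Z : ℝ)| ≤ bigP p * (rho p + 1) := by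
    calc (bigP p : ℝ) * |(Z : ℝ)| = |(T + bigP p * Z) - (T : ℝ)| := by
          rw [add_sub_cancel_left, abs_mul, abs_of_pos hP]
      _ ≤ |T + bigP p * (Z : ℝ)| + |(T : ℝ)| := abs_sub _ _
      _ ≤ _ := by
        norm_num at h2
        linarith
  exact le_of_mul_le_mul_left h3 hP

/-! ### Rounding errors of the constants derived from 𝒫, and recovery of the quotient. -/

theorem abs_P1_sub_le (p : Fin N → ℕ) : |P1 p - bigP p| ≤ Fmt.fp64.u * bigP p := by
  have := Fmt.abs_rn_sub_le_of_onGrid .fp64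
    (onGrid_int (e := Fmt.fp64.qmin) (by norm_num [Fmt.qmin]) (bigP p : ℤ))
  simpa [P1] using this

theorem P1_onGrid (p : Fin N → ℕ) : OnGrid Fmt.fp64.qmin (P1 p) := by
  have := Fmt.fp64.rn_onGrid
    (onGrid_int (e := Fmt.fp64.qmin) (by norm_num [Fmt.qmin]) (bigP p : ℤ))
  simpa [P1] using this

theorem abs_P2_sub_le (p : Fin N → ℕ) : |(bigP p :
    ℝ) - P1 p - P2 p .fp64| ≤ Fmt.fp64.u ^ 2 * bigP p := by
  have hg := (onGrid_int (e := Fmt.fp64.qmin) (by norm_num [Fmt.qmin]) (bigP p : ℤ)).sub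
    (P1_onGrid p)
  have h1 := Fmt.abs_rn_sub_le_of_onGrid .fp64 hg
  have h2 := abs_P1_sub_le p
  have hu := Fmt.fp64.u_pos
  rw [abs_sub_comm] at h1 h2
  simp only [Int.cast_natCast] at h1
  unfold P2
  refine h1.trans ?_
  rw [pow_two, mul_assoc]
  exact mul_le_mul_of_nonneg_left h2 hu.le

theorem P2_onGrid (p : Fin N → ℕ) : OnGrid Fmt.fp64.qmin (P2 p .fp64) := by
  have hg := (onGrid_int (e := Fmt.fp64.qmin) (by norm_num [Fmt.qmin]) (bigP p : ℤ)).sub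
    (P1_onGrid p)
  have := Fmt.fp64.rn_onGrid hg
  simpa [P2] using this

theorem abs_Pinv_sub_le (D : CRTData p T w Z) : |Pinv p - (bigP p : ℝ)⁻¹| ≤ Fmt.fp64.u * (bigP p :
    ℝ)⁻¹ := by
  have hP := D.P_pos
  have hlt : (bigP p : ℝ) < 2 ^ 350 := by exact_mod_cast D.P_lt
  have hn : Fmt.fp64.minNormal ≤ |(bigP p : ℝ)⁻¹| := by
    rw [abs_of_pos (by positivity), le_inv_comm₀ (by unfold Fmt.minNormal; positivity) hP]
    refine hlt.le.trans ?_
    unfold Fmt.minNormal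
    rw [← zpow_neg, ← zpow_natCast]
    apply zpow_le_zpow_right₀ one_le_two
    norm_num [Fmt.qmin, Fmt.prec]
  have h1 := Fmt.fp64.abs_rn_sub_le (bigP p : ℝ)⁻¹
  have h2 := Fmt.fp64.ulp_le_of_minNormal_le hn
  rw [abs_of_pos (by positivity : (0 : ℝ) < (bigP p : ℝ)⁻¹)] at h2
  unfold Pinv
  linarith

/-- The quotient is determined exactly. -/
theorem round_eq (D : CRTData p T w Z) {C : ℝ} (hC : |C - ∑ l, (weight p l : ℝ) * w l| ≤ bigP p *
    (1 / 2 ^ 27)) :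
    round (Fmt.fp64.rn (Pinv p * C)) = Z := by
  have hP := D.P_pos
  have hS := D.abs_sum_le D.abs_weight_le
  have hI := D.abs_Pinv_sub_le
  have hT := D.abs_T_le
  have hr := D.rho_le_real
  have hr0 := D.rho_ge_real
  rw [D.sum_eq_real] at hC hS
  have hrn := Fmt.fp64.abs_rn_sub_le_add (Pinv p * C)
  have hq : (2 : ℝ) ^ Fmt.fp64.qmin ≤ 1 / 2 ^ 40 := by
    rw [one_div, ← zpow_natCast, ← zpow_neg]
    exact zpow_le_zpow_right₀ one_le_two (by norm_num [Fmt.qmin])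
  have hu := Fmt.fp64.u_pos
  -- The margin 2^(-26) on T minus the error 2^(-27) of C. What is left outweighs the errors of
  -- `Pinv` and of the product, each about 2^(-41).
  have hx1 : |(bigP p : ℝ)⁻¹ * C - Z| ≤ 1 / 2 - 1 / 2 ^ 27 := by
    have e : (bigP p : ℝ)⁻¹ * C - Z =
        (bigP p : ℝ)⁻¹ * ((C - (T + bigP p * Z)) + T) := by field_simp; ring
    rw [e, abs_mul, abs_of_pos (by positivity : (0 : ℝ) < (bigP p : ℝ)⁻¹), inv_mul_le_iff₀ hP]
    refine (abs_add_le _ _).trans ?_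
    norm_num at hC hT ⊢
    linarith
  have hx2 : |(bigP p : ℝ)⁻¹ * C| ≤ 4098 := by
    have e : |C| ≤ bigP p * 4098 := by
      have := mul_le_mul_of_nonneg_left hr hP.le
      rw [abs_le] at hC hS ⊢
      norm_num at hC
      constructor <;> linarith
    rw [abs_mul, abs_of_pos (by positivity : (0 : ℝ) < (bigP p : ℝ)⁻¹), inv_mul_le_iff₀ hP]
    exact e
  have hx3 : |Pinv p * C - (bigP p : ℝ)⁻¹ * C| ≤ Fmt.fp64.u * 4098 := by
    rw [← sub_mul, abs_mul]
    refine (mul_le_mul_of_nonneg_right hI (abs_nonneg _)).trans ?_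
    rw [mul_assoc]
    refine mul_le_mul_of_nonneg_left ?_ hu.le
    rwa [← abs_of_pos (by positivity : (0 : ℝ) < (bigP p : ℝ)⁻¹), ← abs_mul]
  have hx4 : |Pinv p * C| ≤ 4099 := by
    rw [u64_eq] at hx3
    rw [abs_le] at hx3 hx2 ⊢
    constructor <;> linarith
  have hx5 := mul_le_mul_of_nonneg_left hx4 hu.le
  apply round_eq_of_abs_sub_lt
  rw [u64_eq] at *
  norm_num at hq hx1
  rw [abs_le] at hrn hx1 hx3
  rw [abs_lt]
  constructor <;> linarith

/-- A rounded product with the quotient is a rounded sum of grid points. -/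
theorem abs_rn_neg_mul_add_sub_le (Z : ℤ) {x y : ℝ} (hx : OnGrid Fmt.fp64.qmin x)
    (hy : OnGrid Fmt.fp64.qmin y) :
    |Fmt.fp64.rn (-(Z : ℝ) * x + y) - (-(Z : ℝ) * x + y)| ≤
      Fmt.fp64.u * |-(Z : ℝ) * x + y| := by
  apply Fmt.abs_rn_sub_le_of_onGrid
  convert (hx.mul_int (-Z)).add hy using 2
  push_cast
  ring

theorem rn_neg_mul_add_onGrid (Z : ℤ) {x y : ℝ} (hx : OnGrid Fmt.fp64.qmin x)
    (hy : OnGrid Fmt.fp64.qmin y) : OnGrid Fmt.fp64.qmin (Fmt.fp64.rn (-(Z : ℝ) * x + y)) := by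
  apply Fmt.rn_onGrid
  convert (hx.mul_int (-Z)).add hy using 2
  push_cast
  ring

/-- Error of a floating-point sum with perturbed weights. -/
theorem abs_flDot_sub_le (D : CRTData p T w Z) {τ : SumTree (Fin N)} (hτ : τ.IsOrder) {x s :
    Fin N → ℝ} {c : ℝ}
    (hx : ∀ l, |x l| ≤ c) (hs : ∀ l, |s l - x l| ≤ Fmt.fp64.u * c)
    (hg : ∀ l, OnGrid Fmt.fp64.qmin (s l)) :
    |τ.flDot s (fun l => (w l : ℝ)) - ∑ l, x l * w l| ≤
      (N + 3) * (Fmt.fp64.u * (c * rho p)) := by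
  have hu := Fmt.fp64.u_pos
  have h49 : (N : ℝ) ≤ 49 := by exact_mod_cast D.le_49
  have h1 := τ.abs_flDot_sub_le (y := w) hg
  rw [τ.leaves_sum_of_isOrder hτ, τ.leaves_sum_of_isOrder hτ, τ.length_leaves_of_isOrder hτ] at h1
  have hs' : ∀ l, |s l| ≤ (1 + Fmt.fp64.u) * c := fun l => by
    have := abs_sub_abs_le_abs_sub (s l) (x l)
    linarith [hs l, hx l]
  have h2 := D.sum_abs_le hs'
  have h3 := D.abs_sum_le hs
  simp only [sub_mul, Finset.sum_sub_distrib] at h3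
  have h4 := one_add_u64_pow_le D.le_49
  have h5 : 0 ≤ ∑ l, |s l * w l| := Finset.sum_nonneg fun l _ => abs_nonneg _
  have h6 := mul_le_mul h4 h2 h5 (by positivity)
  have h7 : 0 ≤ c * rho p := le_trans (Finset.sum_nonneg fun l _ => abs_nonneg _) (D.sum_abs_le hx)
  have h8 := h1.trans h6
  generalize τ.flDot s (fun l => (w l : ℝ)) = F at *
  -- N + 1 units from the summation and one from the perturbed weights; the second-order terms fit
  -- into one more.
  have h9 : |F - ∑ l, x l * w l| ≤ ((N : ℝ) + 1) * Fmt.fp64.u * ((1 + Fmt.fp64.u) * c * rho p) +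
      Fmt.fp64.u * c * rho p := by
    rw [abs_le] at *
    constructor <;> linarith
  refine h9.trans ?_
  have h10 : ((N : ℝ) + 1) * Fmt.fp64.u ≤ 1 := by
    rw [u64_eq]; linarith
  have h11 := mul_le_mul_of_nonneg_right h10 (mul_nonneg hu.le h7)
  linarith

/-! ### Reduction for SGEMM -/

/-- In units of R = u₆₄ρ𝒫 the summation costs N + 3 and replacing 𝒫 by 𝒫₁ costs (ρ + 1)/ρ. The final
1 covers underflow in the conversion to FP32. -/
theorem sgemm_error (D : CRTData p T w Z) {τ₁ : SumTree (Fin N)} (hτ₁ : τ₁.IsOrder) {C : ℝ}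
    (hC : C = τ₁.flDot (s1 p .fp32) (fun l => (w l : ℝ))) :
    round (Fmt.fp64.rn (Pinv p * C)) = Z ∧
    |Fmt.fp32.rn (Fmt.fp64.rn (-(Z : ℝ) * P2 p .fp32 +
      Fmt.fp64.rn (Fmt.fp64.rn (-(Z : ℝ) * P1 p + C) + 0))) - T| ≤
      2 * errR .fp32 p |(T : ℝ)| + 1 := by
  have hq0 : Fmt.fp64.qmin ≤ 0 := by norm_num [Fmt.qmin]
  have hP := D.P_pos
  have hu := Fmt.fp64.u_pos
  have h49 : (N : ℝ) ≤ 49 := by exact_mod_cast D.le_49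
  have h2 : (2 : ℝ) ≤ N := by exact_mod_cast D.two_le
  have hr := D.rho_le_real
  have hr0 := D.rho_ge_real
  have hT := D.abs_T_le
  have hgrid : ∀ l, OnGrid Fmt.fp64.qmin (s1 p .fp32 l) := fun l => by
    have := Fmt.fp64.rn_onGrid (onGrid_int hq0 (weight p l : ℤ))
    simpa [s1] using this
  have hs : ∀ l, |s1 p .fp32 l - weight p l| ≤ Fmt.fp64.u * bigP p := fun l => by
    have := Fmt.abs_rn_sub_le_of_onGrid .fp64 (onGrid_int hq0 (weight p l : ℤ))
    simp only [Int.cast_natCast] at this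
    exact this.trans (mul_le_mul_of_nonneg_left (D.abs_weight_le l) hu.le)
  have hE := D.abs_flDot_sub_le hτ₁ D.abs_weight_le hs hgrid
  have hCg : OnGrid Fmt.fp64.qmin C := by rw [hC]; exact SumTree.flDot_onGrid hgrid τ₁
  rw [← hC] at hE
  have hρP : (bigP p : ℝ) * rho p ≤ bigP p * 4096 := mul_le_mul_of_nonneg_left hr hP.le
  have hρP0 : (bigP p : ℝ) * 255 ≤ bigP p * rho p := mul_le_mul_of_nonneg_left hr0 hP.le
  -- the unit of the error bound
  obtain ⟨R, hR⟩ : ∃ R, R = Fmt.fp64.u * (bigP p * rho p) := ⟨_, rfl⟩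
  have hR1 : R ≤ bigP p * (1 / 2 ^ 41) := by rw [hR, u64_eq]; norm_num; linarith
  have hR2 : Fmt.fp64.u * bigP p ≤ R / 255 := by
    have := mul_le_mul_of_nonneg_left hρP0 hu.le
    rw [hR]; linarith
  have hR0 : 0 ≤ R := by rw [hR]; positivity
  rw [← hR] at hE
  have hNR : ((N : ℝ) + 3) * R ≤ 52 * R := mul_le_mul_of_nonneg_right (by linarith) hR0
  have hQ := D.round_eq (C := C) (hE.trans (by norm_num at hR1 ⊢; linarith))
  refine ⟨hQ, ?_⟩
  rw [D.sum_eq_real] at hE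
  -- the first reduction step
  have hZ : |(Z : ℝ) * (bigP p - P1 p)| ≤ R + R / 255 := by
    have h1 := abs_P1_sub_le p
    rw [abs_sub_comm] at h1
    rw [abs_mul]
    refine (mul_le_mul D.abs_Z_le h1 (abs_nonneg _) (by positivity)).trans ?_
    have : ((rho p : ℝ) + 1) * (Fmt.fp64.u * bigP p) = R + Fmt.fp64.u * bigP p := by
      rw [hR]; ring
    linarith
  have r1 := abs_rn_neg_mul_add_sub_le Z (P1_onGrid p) hCg
  have g1 := rn_neg_mul_add_onGrid Z (P1_onGrid p) hCg
  have e1 : |-(Z : ℝ) * P1 p + C - T| ≤ (N + 3) * R + (R + R / 255) := by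
    rw [abs_le] at *
    constructor <;> linarith
  -- Every intermediate value of the reduction is below 𝒫 in modulus, so a rounding costs at most u𝒫
  -- ≤ R/255, as ρ ≥ 255.
  have step : ∀ {x y : ℝ}, |x - y| ≤ Fmt.fp64.u * |y| → |y - T| ≤ (N + 3) * R + 2 * R →
      |x - y| ≤ R / 255 := by
    intro x y hxy hy
    refine (hxy.trans (mul_le_mul_of_nonneg_left ?_ hu.le)).trans hR2
    norm_num at hR1 hT
    rw [abs_le] at *
    constructor <;> linarith
  generalize Fmt.fp64.rn (-(Z : ℝ) * P1 p + C) = T1 at *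
  have f1 := step r1 (by linarith)
  have e2 : |T1 + 0 - T| ≤ (N + 3) * R + (R + 2 * (R / 255)) := by
    rw [abs_le] at e1 f1 ⊢
    constructor <;> linarith
  have r2 := Fmt.abs_rn_sub_le_of_onGrid .fp64 (x := T1 + 0) (by simpa using g1)
  have g2 := Fmt.fp64.rn_onGrid (x := T1 + 0) (e := Fmt.fp64.qmin) (by simpa using g1)
  have f2 := step r2 (by linarith)
  generalize Fmt.fp64.rn (T1 + 0) = T2 at *
  have hP2 : -(Z : ℝ) * P2 p .fp32 + T2 = T2 := by simp [P2]
  rw [hP2]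
  have e3 : |T2 - T| ≤ (N + 3) * R + (R + 3 * (R / 255)) := by
    rw [abs_le] at e2 f2 ⊢
    constructor <;> linarith
  have r3 := Fmt.abs_rn_sub_le_of_onGrid .fp64 g2
  have f3 := step r3 (by linarith)
  generalize Fmt.fp64.rn T2 = T3 at *
  have e4 : |T3 - T| ≤ (N + 5) * R := by
    rw [abs_le] at e3 f3 ⊢
    constructor <;> linarith
  have r4 := Fmt.fp32.abs_rn_sub_le_add T3
  have hq : (2 : ℝ) ^ Fmt.fp32.qmin ≤ 1 :=
    zpow_le_one_of_nonpos₀ one_le_two (by norm_num [Fmt.qmin])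
  have habs : |T3| ≤ |(T : ℝ)| + (N + 5) * R := by
    have := abs_sub_abs_le_abs_sub T3 (T : ℝ)
    linarith
  have e5 := mul_le_mul_of_nonneg_left habs Fmt.fp32.u_pos.le
  have hfin : |Fmt.fp32.rn T3 - T| ≤ (1 + Fmt.fp32.u) * ((N + 5) * R) +
      Fmt.fp32.u * |(T : ℝ)| + 1 := by
    have := abs_sub_le (Fmt.fp32.rn T3) T3 T
    linarith
  refine hfin.trans ?_
  have hR' : (1 + Fmt.fp32.u) * (N + 2) * Fmt.fp64.u * rho p * bigP p =
      (1 + Fmt.fp32.u) * ((N + 2) * R) := by rw [hR]; ring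
  unfold errR
  simp only
  rw [hR']
  have h32 := Fmt.fp32.u_pos
  have : ((N : ℝ) + 5) * R ≤ 2 * ((N + 2) * R) := by nlinarith
  have := mul_le_mul_of_nonneg_left this (by linarith : (0 : ℝ) ≤ 1 + Fmt.fp32.u)
  have : 0 ≤ Fmt.fp32.u * |(T : ℝ)| := by positivity
  linarith

/-! ### Reduction for DGEMM -/

/-- The exponent of the last bit kept in the leading parts of the weights. -/
theorem exists_split (D : CRTData p T w Z) : ∃ g : ℤ, Fmt.fp64.qmin ≤ g ∧
    (∀ l, OnGrid g (s1 p .fp64 l) ∧ 0 ≤ s1 p .fp64 l ∧ s1 p .fp64 l ≤ weight p l ∧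
      (weight p l : ℝ) - s1 p .fp64 l ≤ (2 : ℝ) ^ g) ∧
    ∑ l, |(weight p l : ℝ) * w l| < (2 : ℝ) ^ (g + 53) ∧
    (2 : ℝ) ^ g ≤ (2 : ℝ) ^ (1 + ceilLogRho p) * Fmt.fp64.u * bigP p := by
  have hN : Nonempty (Fin N) := ⟨⟨0, by have := D.two_le; omega⟩⟩
  obtain ⟨M, hM⟩ : ∃ M : ℝ, M = ⨆ h, (weight p h : ℝ) := ⟨_, rfl⟩
  have hle : ∀ l, (weight p l : ℝ) ≤ M := fun l => by
    rw [hM]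
    exact le_ciSup (f := fun h => (weight p h : ℝ)) (Set.finite_range _).bddAbove l
  have hM1 : 1 ≤ M := by
    refine le_trans ?_ (hle hN.some)
    exact_mod_cast D.weight_pos hN.some
  have hMP : M ≤ bigP p := by
    rw [hM]
    exact ciSup_le fun l => by exact_mod_cast (D.weight_lt l).le
  have hMpos : 0 < M := by linarith
  have hr0 := D.rho_ge_real
  have hρ : (rho p : ℝ) ≤ (2 : ℝ) ^ ceilLogRho p := by
    rw [← Real.rpow_intCast, ← Real.logb_le_iff_le_rpow one_lt_two (by linarith)]
    exact Int.le_ceil _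
  have hc : 0 ≤ ceilLogRho p :=
    Int.ceil_nonneg (Real.logb_nonneg one_lt_two (by linarith))
  have hf : 0 ≤ ⌊Real.logb 2 M⌋ := Int.floor_nonneg.2 (Real.logb_nonneg one_lt_two hM1)
  -- The number of kept bits varies with ℓ precisely so that the last kept bit has the same exponent
  -- for all weights.
  refine ⟨ceilLogRho p + ⌊Real.logb 2 M⌋ - 52, by norm_num [Fmt.qmin]; omega, fun l => ?_, ?_, ?_⟩
  · have he : ⌊Real.logb 2 (weight p l)⌋ + 1 - keepBits p l =
        ceilLogRho p + ⌊Real.logb 2 M⌋ - 52 := by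
      unfold keepBits
      rw [← hM]
      ring
    have hs : s1 p .fp64 l = upperBits (keepBits p l) (weight p l) := rfl
    rw [hs]
    unfold upperBits
    rw [he]
    refine ⟨⟨_, rfl⟩, ?_⟩
    have hpos : (0 : ℝ) < 2 ^ (ceilLogRho p + ⌊Real.logb 2 M⌋ - 52) := by positivity
    generalize (2 : ℝ) ^ (ceilLogRho p + ⌊Real.logb 2 M⌋ - 52) = q at *
    refine ⟨?_, ?_, ?_⟩
    · have : 0 ≤ ⌊(weight p l : ℝ) / q⌋ := Int.floor_nonneg.2 (by positivity)
      have : (0 : ℝ) ≤ ⌊(weight p l : ℝ) / q⌋ := by exact_mod_cast this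
      positivity
    · rw [← le_div_iff₀ hpos]
      exact Int.floor_le _
    · have := Int.lt_floor_add_one ((weight p l : ℝ) / q)
      rw [div_lt_iff₀ hpos] at this
      linarith
  · refine (D.sum_abs_le (c := M) fun l => by rw [Nat.abs_cast]; exact hle l).trans_lt ?_
    rw [show ceilLogRho p + ⌊Real.logb 2 M⌋ - 52 + 53 =
      (⌊Real.logb 2 M⌋ + 1) + ceilLogRho p by ring,
      zpow_add₀ two_ne_zero]
    exact mul_lt_mul (lt_zpow_floor_logb hMpos) hρ (by linarith) (by positivity)
  · have h1 : (2 : ℝ) ^ ⌊Real.logb 2 M⌋ ≤ bigP p := (zpow_floor_logb_le hMpos).trans hMP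
    have h2 : (2 : ℝ) ^ (ceilLogRho p + ⌊Real.logb 2 M⌋ - 52) =
        (2 : ℝ) ^ (1 + ceilLogRho p) * Fmt.fp64.u * 2 ^ ⌊Real.logb 2 M⌋ := by
      rw [show ceilLogRho p + ⌊Real.logb 2 M⌋ - 52 =
        (1 + ceilLogRho p) + (-53) + ⌊Real.logb 2 M⌋ by ring, zpow_add₀ two_ne_zero,
        zpow_add₀ two_ne_zero]
      simp [Fmt.u, Fmt.prec]
    rw [h2]
    have := Fmt.fp64.u_pos
    gcongr

theorem ceilLogRho_bounds (D : CRTData p T w Z) :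
    510 ≤ (2 : ℝ) ^ (1 + ceilLogRho p) ∧ (2 : ℝ) ^ (1 + ceilLogRho p) ≤ 8192 := by
  have hr := D.rho_le_real
  have hr0 := D.rho_ge_real
  have hρ : (rho p : ℝ) ≤ (2 : ℝ) ^ ceilLogRho p := by
    rw [← Real.rpow_intCast, ← Real.logb_le_iff_le_rpow one_lt_two (by linarith)]
    exact Int.le_ceil _
  have hc : ceilLogRho p ≤ 12 := by
    unfold ceilLogRho
    rw [Int.ceil_le, Real.logb_le_iff_le_rpow one_lt_two (by linarith), Real.rpow_intCast]
    exact hr.trans (by norm_num)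
  have h12 : (2 : ℝ) ^ ceilLogRho p ≤ 2 ^ (12 : ℤ) := zpow_le_zpow_right₀ one_le_two hc
  rw [zpow_add₀ two_ne_zero, zpow_one]
  norm_num at h12
  constructor <;> linarith

/-- The sum of the leading parts is exact and differs from T + 𝒫Z by the low part S, with |S| ≤ G of
order u𝒫. After cancellation of the multiple of 𝒫 every rounding acts on |T| plus terms of that
order, giving u|T| and multiples of V. -/
theorem dgemm_error (D : CRTData p T w Z) {τ₁ τ₂ : SumTree (Fin N)} (hτ₁ : τ₁.IsOrder) (hτ₂ :
    τ₂.IsOrder) {C C' : ℝ}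
    (hC : C = τ₁.flDot (s1 p .fp64) (fun l => (w l : ℝ)))
    (hC' : C' = τ₂.flDot (s2 p .fp64) (fun l => (w l : ℝ))) :
    round (Fmt.fp64.rn (Pinv p * C)) = Z ∧
    |Fmt.fp64.rn (-(Z : ℝ) * P2 p .fp64 +
      Fmt.fp64.rn (Fmt.fp64.rn (-(Z : ℝ) * P1 p + C) + C')) - T| ≤
      2 * errR .fp64 p |(T : ℝ)| := by
  have hq0 : Fmt.fp64.qmin ≤ 0 := by norm_num [Fmt.qmin]
  have hP := D.P_pos
  have hu := Fmt.fp64.u_pos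
  have h49 : (N : ℝ) ≤ 49 := by exact_mod_cast D.le_49
  have h2 : (2 : ℝ) ≤ N := by exact_mod_cast D.two_le
  have hr := D.rho_le_real
  have hr0 := D.rho_ge_real
  have hcb := D.ceilLogRho_bounds
  obtain ⟨g, hg, hs, hsum, h2g⟩ := D.exists_split
  obtain ⟨K, hK⟩ : ∃ K : ℝ, K = (2 : ℝ) ^ (1 + ceilLogRho p) := ⟨_, rfl⟩
  rw [← hK] at hcb h2g
  -- the leading parts are summed exactly
  have hCsum : C = ∑ l, s1 p .fp64 l * w l := by
    rw [hC, SumTree.flDot_eq_sum hg (fun l => (hs l).1), τ₁.leaves_sum_of_isOrder hτ₁]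
    rw [τ₁.leaves_sum_of_isOrder hτ₁]
    refine lt_of_le_of_lt (Finset.sum_le_sum fun l _ => ?_) hsum
    rw [abs_mul, abs_mul]
    refine mul_le_mul_of_nonneg_right ?_ (abs_nonneg _)
    rw [abs_of_nonneg (hs l).2.1, Nat.abs_cast]
    exact (hs l).2.2.1
  have hd : ∀ l, |(weight p l : ℝ) - s1 p .fp64 l| ≤ (2 : ℝ) ^ g := fun l => by
    rw [abs_of_nonneg (by linarith [(hs l).2.2.1])]
    exact (hs l).2.2.2
  have hdg : ∀ l, OnGrid Fmt.fp64.qmin ((weight p l : ℝ) - s1 p .fp64 l) := fun l => by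
    have := (onGrid_int hq0 (weight p l : ℤ)).sub ((hs l).1.mono hg)
    simpa using this
  obtain ⟨G, hG⟩ : ∃ G : ℝ, G = (2 : ℝ) ^ g * rho p := ⟨_, rfl⟩
  have hDC : C + ∑ l, ((weight p l : ℝ) - s1 p .fp64 l) * w l = T + bigP p * Z := by
    rw [← D.sum_eq_real, hCsum, ← Finset.sum_add_distrib]
    exact Finset.sum_congr rfl fun l _ => by ring
  have hDle := D.abs_sum_le hd
  rw [← hG] at hDle
  have hgrid2 : ∀ l, OnGrid Fmt.fp64.qmin (s2 p .fp64 l) := fun l => Fmt.fp64.rn_onGrid (hdg l)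
  have hE := D.abs_flDot_sub_le hτ₂ hd (s := s2 p .fp64) (fun l =>
    (Fmt.abs_rn_sub_le_of_onGrid .fp64 (hdg l)).trans
      (mul_le_mul_of_nonneg_left (hd l) hu.le)) hgrid2
  rw [← hC', ← hG] at hE
  have hCg : OnGrid Fmt.fp64.qmin C := by
    rw [hC]; exact SumTree.flDot_onGrid (fun l => (hs l).1.mono hg) τ₁
  have hCg' : OnGrid Fmt.fp64.qmin C' := by
    rw [hC']; exact SumTree.flDot_onGrid hgrid2 τ₂
  have hρP : (bigP p : ℝ) * rho p ≤ bigP p * 4096 := mul_le_mul_of_nonneg_left hr hP.le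
  have hρP0 : (bigP p : ℝ) * 255 ≤ bigP p * rho p := mul_le_mul_of_nonneg_left hr0 hP.le
  have hGle : G ≤ K * Fmt.fp64.u * bigP p * rho p := by
    rw [hG]; exact mul_le_mul_of_nonneg_right h2g (by positivity)
  have hG0 : 0 ≤ G := by rw [hG]; positivity
  have hGP : G ≤ bigP p * (1 / 2 ^ 28) := by
    have h1 : K * (bigP p * rho p) ≤ 8192 * (bigP p * 4096) :=
      mul_le_mul hcb.2 hρP (by positivity) (by norm_num)
    rw [u64_eq] at hGle
    norm_num
    linarith
  generalize (∑ l, ((weight p l : ℝ) - s1 p .fp64 l) * w l) = S at *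
  have hQ := D.round_eq (C := C) (by
    rw [D.sum_eq_real, ← hDC, sub_add_cancel_left, abs_neg]
    norm_num at hGP ⊢
    linarith)
  refine ⟨hQ, ?_⟩
  -- the unit of the error bound
  obtain ⟨V, hV⟩ : ∃ V : ℝ, V = K * Fmt.fp64.u ^ 2 * rho p * bigP p := ⟨_, rfl⟩
  have hV0 : 0 ≤ V := by rw [hV]; have := hcb.1; positivity
  have hGV : Fmt.fp64.u * G ≤ V := by
    have := mul_le_mul_of_nonneg_left hGle hu.le
    rw [hV]; linarith
  obtain ⟨H, hH⟩ : ∃ H : ℝ, H = (rho p + 1) * (Fmt.fp64.u * bigP p) := ⟨_, rfl⟩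
  have hH0 : 0 ≤ H := by rw [hH]; positivity
  have hHV : Fmt.fp64.u * H ≤ V / 500 := by
    have h1 : (rho p : ℝ) + 1 ≤ (1 + 1 / 255) * rho p := by linarith
    -- Uses K ≥ 510 and ρ ≥ 255.
    have h3 : ((rho p : ℝ) + 1) * 500 ≤ K * rho p := by nlinarith
    have h4 := mul_le_mul_of_nonneg_right h3
      (by positivity : (0 : ℝ) ≤ Fmt.fp64.u ^ 2 * bigP p)
    rw [hH, hV]
    linarith
  have hZ : |(Z : ℝ) * (bigP p - P1 p)| ≤ H := by
    have h1 := abs_P1_sub_le p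
    rw [abs_sub_comm] at h1
    rw [abs_mul, hH]
    exact mul_le_mul D.abs_Z_le h1 (abs_nonneg _) (by positivity)
  have hZ2 : |(Z : ℝ) * (bigP p - P1 p - P2 p .fp64)| ≤ V / 500 := by
    rw [abs_mul]
    refine (mul_le_mul D.abs_Z_le (abs_P2_sub_le p) (abs_nonneg _) (by positivity)).trans ?_
    refine le_trans (le_of_eq ?_) hHV
    rw [hH]; ring
  have hE' : |C' - S| ≤ (N + 3) * V :=
    hE.trans (mul_le_mul_of_nonneg_left hGV (by positivity))
  have hNV : ((N : ℝ) + 3) * V ≤ 52 * V := mul_le_mul_of_nonneg_right (by linarith) hV0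
  have hNV0 : 0 ≤ ((N : ℝ) + 3) * V := by positivity
  have hX0 := abs_nonneg (T : ℝ)
  -- first step
  have r1 := abs_rn_neg_mul_add_sub_le Z (P1_onGrid p) hCg
  have g1 := rn_neg_mul_add_onGrid Z (P1_onGrid p) hCg
  have b1 : |-(Z : ℝ) * P1 p + C| ≤ |(T : ℝ)| + G + H := by
    have e : -(Z : ℝ) * P1 p + C = T - S + Z * (bigP p - P1 p) := by linarith
    rw [e]
    have := abs_add_le ((T : ℝ) - S) (Z * (bigP p - P1 p))
    have := abs_sub (T : ℝ) S
    linarith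
  have f1 := r1.trans (mul_le_mul_of_nonneg_left b1 hu.le)
  have f1' : |Fmt.fp64.rn (-(Z : ℝ) * P1 p + C) - (-(Z : ℝ) * P1 p + C)| ≤
      Fmt.fp64.u * |(T : ℝ)| + V + V / 500 := by linarith
  obtain ⟨y, hy⟩ : ∃ y : ℝ, y = -(Z : ℝ) * P1 p + C := ⟨_, rfl⟩
  rw [← hy] at f1' g1 ⊢
  generalize Fmt.fp64.rn y = T1 at *
  -- second step
  have hT2 : |T1 + C' - (T + Z * (bigP p - P1 p))| ≤
      Fmt.fp64.u * |(T : ℝ)| + V + V / 500 + (N + 3) * V := by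
    have e : T1 + C' - (T + Z * (bigP p - P1 p)) = (T1 - y) + (C' - S) := by
      rw [hy]; linarith
    rw [e]
    have := abs_add_le (T1 - y) (C' - S)
    linarith
  have r2 := Fmt.abs_rn_sub_le_of_onGrid .fp64 (g1.add hCg')
  have g2 := Fmt.fp64.rn_onGrid (g1.add hCg')
  have b2 : |T1 + C'| ≤ 2 * |(T : ℝ)| + H + 60 * V := by
    have h1 := abs_sub_abs_le_abs_sub (T1 + C') (T + Z * (bigP p - P1 p))
    have h3 := abs_add_le (T : ℝ) (Z * (bigP p - P1 p))
    have : Fmt.fp64.u * |(T : ℝ)| ≤ |(T : ℝ)| := by rw [u64_eq]; linarith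
    linarith
  have b2' : Fmt.fp64.u * |T1 + C'| ≤ Fmt.fp64.u * (2 * |(T : ℝ)|) + V / 500 + V / 500 := by
    have h1 := mul_le_mul_of_nonneg_left b2 hu.le
    have h3 : Fmt.fp64.u * (60 * V) ≤ V / 500 := by rw [u64_eq]; linarith
    linarith
  have f2 := r2.trans b2'
  obtain ⟨z, hz⟩ : ∃ z : ℝ, z = T1 + C' := ⟨_, rfl⟩
  rw [← hz] at f2 hT2 g2 ⊢
  generalize Fmt.fp64.rn z = T2 at *
  -- third step
  have r3 := abs_rn_neg_mul_add_sub_le Z (P2_onGrid p) g2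
  have hT3 : |-(Z : ℝ) * P2 p .fp64 + T2 - T| ≤
      3 * (Fmt.fp64.u * |(T : ℝ)|) + (N + 3) * V + V + V / 100 := by
    have e : -(Z : ℝ) * P2 p .fp64 + T2 - T =
        (T2 - z) + (z - (T + Z * (bigP p - P1 p))) + Z * (bigP p - P1 p - P2 p .fp64) := by ring
    rw [e]
    have := abs_add_three (T2 - z) (z - (T + Z * (bigP p - P1 p)))
      (Z * (bigP p - P1 p - P2 p .fp64))
    linarith
  have b3 : |-(Z : ℝ) * P2 p .fp64 + T2| ≤ 2 * |(T : ℝ)| + 60 * V := by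
    have h1 := abs_sub_abs_le_abs_sub (-(Z : ℝ) * P2 p .fp64 + T2) T
    have : Fmt.fp64.u * |(T : ℝ)| ≤ |(T : ℝ)| / 3 := by rw [u64_eq]; linarith
    linarith
  have b3' : Fmt.fp64.u * |-(Z : ℝ) * P2 p .fp64 + T2| ≤
      2 * (Fmt.fp64.u * |(T : ℝ)|) + V / 500 := by
    have h1 := mul_le_mul_of_nonneg_left b3 hu.le
    have h3 : Fmt.fp64.u * (60 * V) ≤ V / 500 := by rw [u64_eq]; linarith
    linarith
  -- The total is 5u|T| and slightly more than (N + 4)V, within twice 3u|T| + (N + 2)V.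
  have hfin := (abs_sub_le _ _ (T : ℝ)).trans (add_le_add (r3.trans b3') hT3)
  refine hfin.trans ?_
  have hR' : (1 + 3 * Fmt.fp64.u) * (2 : ℝ) ^ (1 + ceilLogRho p) * (N + 2) * Fmt.fp64.u ^ 2 *
      rho p * bigP p = (1 + 3 * Fmt.fp64.u) * ((N + 2) * V) := by rw [hV, hK]; ring
  unfold errR
  simp only
  rw [hR']
  have h5 : 0 ≤ 3 * Fmt.fp64.u * ((N + 2) * V) := by positivity
  have h6 : 0 ≤ Fmt.fp64.u * |(T : ℝ)| := by positivity
  have h7 : 2 * V ≤ N * V := mul_le_mul_of_nonneg_right h2 hV0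
  linarith

end CRTData


/-! ### The error of the emulation -/

theorem crt_error {m k n N : ℕ} (b : Fmt) {p : Fin N → ℕ}
    {τ₁ τ₂ : SumTree (Fin N)} (hτ₁ : τ₁.IsOrder) (hτ₂ : τ₂.IsOrder)
    {A' : Matrix (Fin m) (Fin k) ℤ} {B' : Matrix (Fin k) (Fin n) ℤ} {i : Fin m} {j : Fin n}
    {Z : ℤ} (D : CRTData p ((A' * B') i j) (fun l => W p A' B' l i j) Z) :
    |crt b p τ₁ τ₂ A' B' i j - (((A' * B') i j : ℤ) : ℝ)| ≤
      2 * errR b p |(((A' * B') i j : ℤ) : ℝ)| + 1 := by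
  cases b with
  | fp32 =>
    obtain ⟨hQ, h⟩ := D.sgemm_error hτ₁ rfl
    have hQ' : Q .fp32 p τ₁ A' B' i j = Z := hQ
    have h2 : C2 .fp32 p τ₂ A' B' i j = 0 := by
      have := τ₂.abs_flDot_sub_le (x := s2 p .fp32) (y := fun l => W p A' B' l i j)
        fun l => ⟨0, by simp [s2]⟩
      simpa [s2, C2] using this
    unfold crt Cred
    simp only
    rw [hQ', h2]
    exact h
  | fp64 =>
    obtain ⟨hQ, h⟩ := D.dgemm_error hτ₁ hτ₂ rfl rfl
    have hQ' : Q .fp64 p τ₁ A' B' i j = Z := hQ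
    unfold crt Cred
    simp only
    rw [hQ']
    exact h.trans (by linarith)

theorem crt_fitsPrec {m k n N : ℕ} (b : Fmt) (p : Fin N → ℕ) (τ₁ τ₂ : SumTree (Fin N))
    (A' : Matrix (Fin m) (Fin k) ℤ) (B' : Matrix (Fin k) (Fin n) ℤ) (i : Fin m) (j : Fin n) :
    b.FitsPrec (crt b p τ₁ τ₂ A' B' i j) := by
  cases b
  · exact Fmt.rn_fitsPrec .fp32 _
  · exact Fmt.rn_fitsPrec .fp64 _

/-- Without underflow the inverse scaling is exact. -/
theorem osII_eq {m k n N : ℕ} {b : Fmt} {log2f : ℝ → ℝ} {p : Fin N → ℕ} {τ₁ τ₂ : SumTree (Fin N)}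
    {A : Matrix (Fin m) (Fin k) ℝ} {B : Matrix (Fin k) (Fin n) ℝ} {i : Fin m} {j : Fin n}
    (h : ScalingNoUnderflow b log2f p τ₁ τ₂ A B i j) :
    osII b log2f p τ₁ τ₂ A B i j =
      (2 : ℝ) ^ (-mu A B log2f p i) * Cpp b log2f p τ₁ τ₂ A B i j *
        (2 : ℝ) ^ (-nu A B log2f p j) := by
  have hf : b.FitsPrec (Cpp b log2f p τ₁ τ₂ A B i j) := crt_fitsPrec b p τ₁ τ₂ _ _ i j
  have h1 := (hf.zpow_mul (-mu A B log2f p i)).rn_eq_self h.1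
  have h2 := ((hf.zpow_mul (-mu A B log2f p i)).zpow_mul (-nu A B log2f p j)).rn_eq_self
    (by rw [mul_comm]; exact h.2)
  unfold osII
  rw [h1, mul_comm _ ((2 : ℝ) ^ (-nu A B log2f p j)), h2]

/-- The second bound, due to truncation towards zero, is what avoids a product of two truncation
errors. -/
theorem abs_sub_zpow_mul_trunc_le (x : ℝ) (e : ℤ) :
    |x - (2 : ℝ) ^ (-e) * trunc ((2 : ℝ) ^ e * x)| ≤ (2 : ℝ) ^ (-e) ∧
      |(2 : ℝ) ^ (-e) * trunc ((2 : ℝ) ^ e * x)| ≤ |x| := by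
  have he : (2 : ℝ) ^ (-e) * 2 ^ e = 1 := by
    rw [← zpow_add₀ two_ne_zero, neg_add_cancel, zpow_zero]
  have hp : (0 : ℝ) < 2 ^ (-e) := by positivity
  have hx : x = (2 : ℝ) ^ (-e) * (2 ^ e * x) := by rw [← mul_assoc, he, one_mul]
  constructor
  · have h := abs_trunc_sub_le ((2 : ℝ) ^ e * x)
    rw [abs_sub_comm] at h
    calc _ = |(2 : ℝ) ^ (-e) * ((2 : ℝ) ^ e * x - trunc ((2 : ℝ) ^ e * x))| := by
          rw [mul_sub, ← hx]
      _ ≤ _ := by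
          rw [abs_mul, abs_of_pos hp]
          nlinarith
  · calc _ ≤ (2 : ℝ) ^ (-e) * |(2 : ℝ) ^ e * x| := by
          rw [abs_mul, abs_of_pos hp]
          exact mul_le_mul_of_nonneg_left (abs_trunc_le _) hp.le
      _ = |x| := by
          conv_rhs => rw [hx]
          rw [abs_mul _ ((2 : ℝ) ^ e * x), abs_of_pos hp]

/-- The truncation error. -/
theorem abs_mul_sub_scaled_le {m k n N : ℕ} {log2f : ℝ → ℝ} {p : Fin N → ℕ}
    (A : Matrix (Fin m) (Fin k) ℝ) (B : Matrix (Fin k) (Fin n) ℝ) (i : Fin m) (j : Fin n) :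
    |(A * B) i j - (2 : ℝ) ^ (-mu A B log2f p i) *
      (((Aint A B log2f p * Bint A B log2f p) i j : ℤ) : ℝ) * (2 : ℝ) ^ (-nu A B log2f p j)| ≤
      (∑ h, |A i h|) * (2 : ℝ) ^ (-nu A B log2f p j) +
        (2 : ℝ) ^ (-mu A B log2f p i) * ∑ h, |B h j| := by
  rw [Matrix.mul_apply, Matrix.mul_apply]
  push_cast
  rw [Finset.mul_sum, Finset.sum_mul, ← Finset.sum_sub_distrib, Finset.mul_sum, Finset.sum_mul,
    ← Finset.sum_add_distrib]
  refine (Finset.abs_sum_le_sum_abs _ _).trans (Finset.sum_le_sum fun h _ => ?_)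
  have hA := abs_sub_zpow_mul_trunc_le (A i h) (mu A B log2f p i)
  have hB := abs_sub_zpow_mul_trunc_le (B h j) (nu A B log2f p j)
  rw [mul_comm _ (B h j)] at hB
  unfold Aint Bint
  generalize (trunc ((2 : ℝ) ^ mu A B log2f p i * A i h) : ℝ) = x at *
  generalize (trunc (B h j * (2 : ℝ) ^ nu A B log2f p j) : ℝ) = y at *
  generalize (2 : ℝ) ^ (-mu A B log2f p i) = r at *
  generalize (2 : ℝ) ^ (-nu A B log2f p j) = s at *
  have e : A i h * B h j - r * (x * y) * s =
      A i h * (B h j - s * y) + (A i h - r * x) * (s * y) := by ring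
  rw [e]
  refine (abs_add_le _ _).trans ?_
  rw [abs_mul, abs_mul]
  exact add_le_add (mul_le_mul_of_nonneg_left hB.1 (abs_nonneg _))
    (mul_le_mul hA.1 hB.2 (abs_nonneg _) ((abs_nonneg _).trans hA.1))

theorem errR_nonneg {N : ℕ} (b : Fmt) (p : Fin N → ℕ) {x : ℝ} (hx : 0 ≤ x) : 0 ≤ errR b p x := by
  have := Fmt.fp32.u_pos
  have := Fmt.fp64.u_pos
  cases b <;> unfold errR <;> positivity

theorem errR_mono {N : ℕ} (b : Fmt) (p : Fin N → ℕ) {x y : ℝ} (hxy : x ≤ y) :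
    errR b p x ≤ errR b p y := by
  have := Fmt.fp32.u_pos
  have := Fmt.fp64.u_pos
  cases b <;> unfold errR <;> simp only <;> gcongr

end OzakiII
end

/-! ### Assembly of the error bound. -/

theorem theorem2 (b : OzakiII.Fmt) (N m k n : ℕ) (hN2 : 2 ≤ N) (hN49 : N ≤ 49) (hk : k ≤ 2 ^ 17)
    (log2f : ℝ → ℝ) (hlog2f : OzakiII.IsLog2f log2f)
    (τ₁ τ₂ : OzakiII.SumTree (Fin N)) (hτ₁ : τ₁.IsOrder) (hτ₂ : τ₂.IsOrder)
    (A : Matrix (Fin m) (Fin k) ℝ) (B : Matrix (Fin k) (Fin n) ℝ)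
    (hA : ∀ i h, A i h ∈ b.F) (hB : ∀ h j, B h j ∈ b.F)
    -- no row and no column of `|A| |B|` is identically zero
    (hrow : ∀ i, ∃ j h, A i h * B h j ≠ 0) (hcol : ∀ j, ∃ i h, A i h * B h j ≠ 0)
    (p : Fin N → ℕ) (hp : p = OzakiII.moduli N)
    (C : Matrix (Fin m) (Fin n) ℝ) (hC : C = OzakiII.osII b log2f p τ₁ τ₂ A B)
    (A' : Matrix (Fin m) (Fin k) ℤ) (hA' : A' = OzakiII.Aint A B log2f p)
    (B' : Matrix (Fin k) (Fin n) ℤ) (hB' : B' = OzakiII.Bint A B log2f p)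
    (α' : Fin m → ℝ) (hα' : α' = OzakiII.alpha' A B)
    (β' : Fin n → ℝ) (hβ' : β' = OzakiII.beta' A B)
    (t : ℝ) (ht : t = OzakiII.tConst p) (i : Fin m) (j : Fin n) :
    (OzakiII.ScalingNoUnderflow b log2f p τ₁ τ₂ A B i j →
      |(A * B) i j - C i j| ≤
        t * (∑ h, |A i h|) * (2 : ℝ) ^ β' j + t * (2 : ℝ) ^ α' i * (∑ h, |B h j|)
          + (k + OzakiII.errR b p |(((A' * B') i j : ℤ) : ℝ)|)
            * (t ^ 2 * (2 : ℝ) ^ α' i * (2 : ℝ) ^ β' j)) ∧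
    t * (∑ h, |A i h|) * (2 : ℝ) ^ β' j + t * (2 : ℝ) ^ α' i * (∑ h, |B h j|)
          + (k + OzakiII.errR b p |(((A' * B') i j : ℤ) : ℝ)|)
            * (t ^ 2 * (2 : ℝ) ^ α' i * (2 : ℝ) ^ β' j) ≤
      t * (∑ h, |A i h|) * (2 : ℝ) ^ β' j + t * (2 : ℝ) ^ α' i * (∑ h, |B h j|)
          + (k + OzakiII.errR b p ((OzakiII.bigP p : ℝ) / 2))
            * (t ^ 2 * (2 : ℝ) ^ α' i * (2 : ℝ) ^ β' j) := by
  subst hp hC hA' hB' hα' hβ' ht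
  have hlt : ∀ l : Fin N, (l : ℕ) < 49 := fun l => l.2.trans_le hN49
  have hbd : ∀ l, 29 ≤ OzakiII.moduli N l ∧ OzakiII.moduli N l ≤ 256 := fun l =>
    OzakiII.moduliList_bounds l (hlt l)
  have hcop : ∀ l h, l ≠ h → (OzakiII.moduli N l).Coprime (OzakiII.moduli N h) := fun l h hlh =>
    OzakiII.moduliList_coprime l (hlt l) h (hlt h) (Fin.val_ne_of_ne hlh)
  have hPnum := OzakiII.bigP_numeric N (by omega) hN2
  simp only [← OzakiII.bigP_moduli] at hPnum
  obtain ⟨hP15, hP350, hgap⟩ := hPnum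
  have hρ := OzakiII.rho_numeric N (by omega) hN2
  simp only [← OzakiII.rho_moduli] at hρ
  -- From here on only coprimality and the numerical bounds on the moduli, 𝒫 and ρ matter.
  generalize OzakiII.moduli N = p at *
  have hppos : ∀ l, 0 < p l := fun l => by have := hbd l; omega
  have S := OzakiII.scalingSpec hk hlog2f hrow hcol hP15 hP350 hgap i j
  have hW := fun l => OzakiII.W_modEq hk (hppos l) (hbd l).2
    (OzakiII.Aint A B log2f p) (OzakiII.Bint A B log2f p) i j
  obtain ⟨Z, hZ⟩ := OzakiII.exists_sum_weight_mul_eq hppos hcop fun l => (hW l).1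
  have D : OzakiII.CRTData p ((OzakiII.Aint A B log2f p * OzakiII.Bint A B log2f p) i j)
      (fun l => OzakiII.W p (OzakiII.Aint A B log2f p) (OzakiII.Bint A B log2f p) l i j) Z :=
    ⟨hN2, hN49, hP15, hP350, hρ.1, hρ.2,
      OzakiII.weight_pos (fun l => by have := hbd l; omega) hcop, OzakiII.weight_lt hppos,
      S.abs_prod_le,
      fun l => (hW l).2, hZ⟩
  -- A nonzero entry in the row of |A||B| forces an inner index to exist.
  have hk1 : (1 : ℝ) ≤ k := by
    obtain ⟨_, h, _⟩ := hrow i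
    have := h.2
    exact_mod_cast (by omega : 1 ≤ k)
  have hPpos := D.P_pos
  have hT := S.abs_prod_le
  have hμ := S.zpow_mu_le
  have hν := S.zpow_nu_le
  have ht : 0 ≤ OzakiII.tConst p := by unfold OzakiII.tConst; positivity
  have hα : (0 : ℝ) ≤ 2 ^ OzakiII.alpha' A B i := by positivity
  have hβ : (0 : ℝ) ≤ 2 ^ OzakiII.beta' A B j := by positivity
  have hc : (0 : ℝ) < 2 ^ (-(1 / 2 : ℝ)) := by positivity
  have hc1 : (2 : ℝ) ^ (-(1 / 2 : ℝ)) ≤ 1 := Real.rpow_le_one_of_one_le_of_nonpos (by norm_num)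
    (by norm_num)
  have hcc : (2 : ℝ) ^ (-(1 / 2 : ℝ)) * (2 : ℝ) ^ (-(1 / 2 : ℝ)) = 1 / 2 := by
    rw [← Real.rpow_add two_pos]
    norm_num [Real.rpow_neg_one]
  refine ⟨fun hno => ?_, ?_⟩
  · rw [OzakiII.osII_eq hno]
    have h1 := OzakiII.abs_mul_sub_scaled_le (log2f := log2f) (p := p) A B i j
    have h2 : |OzakiII.Cpp b log2f p τ₁ τ₂ A B i j - _| ≤ _ := OzakiII.crt_error b hτ₁ hτ₂ D
    have hR := OzakiII.errR_nonneg b p (abs_nonneg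
      (((OzakiII.Aint A B log2f p * OzakiII.Bint A B log2f p) i j : ℤ) : ℝ))
    generalize OzakiII.errR b p |(((OzakiII.Aint A B log2f p * OzakiII.Bint A B log2f p) i j : ℤ) : ℝ)| =
      R at *
    generalize (((OzakiII.Aint A B log2f p * OzakiII.Bint A B log2f p) i j : ℤ) : ℝ) = X at *
    generalize OzakiII.Cpp b log2f p τ₁ τ₂ A B i j = Y at *
    have hr : (0 : ℝ) < 2 ^ (-OzakiII.mu A B log2f p i) := by positivity
    have hs : (0 : ℝ) < 2 ^ (-OzakiII.nu A B log2f p j) := by positivity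
    generalize (2 : ℝ) ^ (-OzakiII.mu A B log2f p i) = r at *
    generalize (2 : ℝ) ^ (-OzakiII.nu A B log2f p j) = s at *
    generalize (2 : ℝ) ^ OzakiII.alpha' A B i = a at *
    generalize (2 : ℝ) ^ OzakiII.beta' A B j = d at *
    generalize (2 : ℝ) ^ (-(1 / 2 : ℝ)) = c at *
    generalize OzakiII.tConst p = t at *
    have hta : 0 ≤ t * a := mul_nonneg ht hα
    have htd : 0 ≤ t * d := mul_nonneg ht hβ
    have hr1 : r ≤ t * a := hμ.trans (mul_le_of_le_one_right hta hc1)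
    have hs1 : s ≤ t * d := hν.trans (mul_le_of_le_one_right htd hc1)
    have hrs : r * s ≤ (t ^ 2 * a * d) / 2 := by
      refine (mul_le_mul hμ hν hs.le (by positivity)).trans_eq ?_
      calc t * a * c * (t * d * c) = t ^ 2 * a * d * (c * c) := by ring
        _ = _ := by rw [hcc]; ring
    have hA0 : 0 ≤ ∑ h, |A i h| := Finset.sum_nonneg fun h _ => abs_nonneg _
    have hB0 : 0 ≤ ∑ h, |B h j| := Finset.sum_nonneg fun h _ => abs_nonneg _
    have h3 : |r * X * s - r * Y * s| ≤ (k + R) * (t ^ 2 * a * d) := by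
      have e : r * X * s - r * Y * s = (r * s) * (X - Y) := by ring
      rw [e, abs_mul, abs_of_pos (by positivity : 0 < r * s)]
      rw [abs_sub_comm] at h2
      -- The half from the two factors 2^(-1/2) turns 2R + 1 into R + 1/2, and k covers the 1/2.
      calc r * s * |X - Y| ≤ (t ^ 2 * a * d) / 2 * (2 * R + 1) :=
            mul_le_mul hrs h2 (abs_nonneg _) (by positivity)
        _ = (1 / 2 + R) * (t ^ 2 * a * d) := by ring
        _ ≤ _ := by
          refine mul_le_mul_of_nonneg_right (by linarith) (by positivity)
    have h4 := mul_le_mul_of_nonneg_left hs1 hA0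
    have h5 := mul_le_mul_of_nonneg_right hr1 hB0
    have h6 := abs_sub_le ((A * B) i j) (r * X * s) (r * Y * s)
    linarith
  · have hle : |(((OzakiII.Aint A B log2f p * OzakiII.Bint A B log2f p) i j : ℤ) : ℝ)| ≤
        (OzakiII.bigP p : ℝ) / 2 := by
      norm_num at hT
      linarith
    have := OzakiII.errR_mono b p hle
    gcongr
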